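/- Let $N\ge 1$, $p\in[1,\infty)$, let $K\colon\mathbb R^N\to[0,\infty]$ be Lebesgue measurable, not a.e. equal to $0$, with $M:=\int_{\mathbb R^N}|x|^pK(x)\,dx<\infty$, and let $\beta\colon(0,1)\to(0,\infty)$ satisfy $\beta(t)\to\infty$ as $t\to0^+$. Put $K_t(x)=\beta(t)^NK(\beta(t)x)$ and, for $u\in L^p(\mathbb R^N)$, $$F_t(u)=\beta(t)^p\int_{\mathbb R^N}\int_{\mathbb R^N}|u(x)-u(y)|^p\,K_t(x-y)\,dx\,dy .$$ Let $\mathcal S^p=W^{1,p}(\mathbb R^N)$ if $p>1$ and $\mathcal S^1=BV(\mathbb R^N)$. For $\sigma\in\mathbb S^{N-1}$ and $u\in L^p(\mathbb R^N)$ let $\|\sigma\cdot Du\|_p^p$ be $\int|\sigma\cdot Du|^p\,dx$ if $p>1$ and the total variation $|\sigma\cdot Du|(\mathbb R^N)$ if $p=1$, where $\sigma\cdot Du$ is the distributional derivative in direction $\sigma$ (value $\infty$ if it is not in $L^p$, resp. not a finite measure); define $\|Du\|_p^p$ in the same way from the distributional gradient. Let $$\theta_{K,p}(\sigma)=\frac1M\int_0^\infty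 r^{N+p-1}K(r\sigma)\,dr,\qquad \sigma\in\mathbb S^{N-1},$$ $$G(u)=M\int_{\mathbb S^{N-1}}\|\sigma\cdot Du\|_p^p\;\theta_{K,p}(\sigma)\,d\mathscr H^{N-1}(\sigma),$$ where $\mathscr H^{N-1}$ is the surface measure on $\mathbb S^{N-1}$. Then, as $t\to0^+$: (1) $F_t(u)\to G(u)$ for every $u\in\mathcal S^p$. (2) For every sequence $(t_k)\subset(0,1)$ with $t_k\to0$, $F_{t_k}$ $\Gamma$-converges to $G$ on $\mathcal S^p$ with respect to the $L^p$ topology: if $u_k\in L^p$, $u\in\mathcal S^p$ and $u_k\to u$ in $L^p$, then $\liminf_kF_{t_k}(u_k)\ge G(u)$; and every $u\in\mathcal S^p$ is the $L^p$ limit of some $u_k\in\mathcal S^p$ with $\limsup_kF_{t_k}(u_k)\le G(u)$. (3) For every such $(t_k)$, the sequence $(F_{t_k})$ is coercive on $\mathcal S^p$, and so is the constant sequence $(G)$: here $(E_k)$ is coercive on $\mathcal S^p$ if $u_k,u\in L^p$, $u_k\to u$ in $L^p$ and $\liminf_kE_k(u_k)<\infty$ imply $u\in\mathcal S^p$. If,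 in addition, $K$ is radially symmetric (a.e. equal to a function of $|x|$), then (1), (2) and (3) also hold with $G$ replaced by $$G_{\mathrm{rad}}(u)=\frac{\Gamma\left(\frac N2\right)\Gamma\left(\frac{p+1}2\right)}{\sqrt\pi\;\Gamma\left(\frac{N+p}2\right)}\;M\;\|Du\|_p^p .$$ -/

import Mathlib

open MeasureTheory Filter Topology Set
open scoped ENNReal ContDiff

noncomputable section

namespace NonlocalBBM

/-- The Euclidean space `ℝ^N`. -/
abbrev Rn (N : ℕ) := EuclideanSpace ℝ (Fin N)

/-- The exponent `p ∈ [1, ∞)` as an extended non-negative real. -/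
abbrev expo (p : ℝ) : ℝ≥0∞ := ENNReal.ofReal p

variable {N : ℕ}

/-! ### Sobolev and `BV` functions -/

/-- Test functions `C^∞_c(ℝ^N; F)`. -/
def IsTest {F : Type*} [NormedAddCommGroup F] [NormedSpace ℝ F] (φ : Rn N → F) : Prop :=
  ContDiff ℝ ∞ φ ∧ HasCompactSupport φ

/-- The divergence of a vector field. -/
def divergence (Φ : Rn N → Rn N) (x : Rn N) : ℝ :=
  ∑ i : Fin N, fderiv ℝ Φ x (EuclideanSpace.single i 1) i

/-- `g` is the distributional derivative `v · Du` of `u` in the direction `v`. -/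
def HasWeakDirDeriv (u : Rn N → ℝ) (v : Rn N) (g : Rn N → ℝ) : Prop :=
  ∀ φ : Rn N → ℝ, IsTest φ → ∫ x, u x * fderiv ℝ φ x v = - ∫ x, g x * φ x

/-- `G` is the distributional gradient `Du` of `u`. -/
def HasWeakGradient (u : Rn N → ℝ) (G : Rn N → Rn N) : Prop :=
  ∀ v : Rn N, HasWeakDirDeriv u v (fun x => inner ℝ (G x) v)

/-- The total variation `|v · Du|(ℝ^N)` of the distributional derivative in the direction `v`
(it is `∞` when `v · Du` is not a finite measure). -/
def dirVariation (u : Rn N → ℝ) (v : Rn N) : ℝ≥0∞ :=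
  ⨆ φ : {φ : Rn N → ℝ // IsTest φ ∧ ∀ x, |φ x| ≤ 1},
    ENNReal.ofReal (∫ x, u x * fderiv ℝ φ.1 x v)

/-- The total variation `|Du|(ℝ^N)` (it is `∞` when `Du` is not a finite measure). -/
def totalVariation (u : Rn N → ℝ) : ℝ≥0∞ :=
  ⨆ Φ : {Φ : Rn N → Rn N // IsTest Φ ∧ ∀ x, ‖Φ x‖ ≤ 1},
    ENNReal.ofReal (∫ x, u x * divergence Φ.1 x)

/-- `‖v · Du‖_{L^p}^p`: for `p > 1` the integral of `|v · Du|^p`, for `p = 1` the total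
variation of `v · Du`. The value is `∞` when the distribution `v · Du` is not in `L^p`
(respectively, not a finite measure); for `p > 1` the infimum runs over the at most one (up to
null sets) representative of `v · Du`. -/
def dirEnergy (p : ℝ) (u : Rn N → ℝ) (v : Rn N) : ℝ≥0∞ :=
  if p = 1 then dirVariation u v
  else ⨅ g : {g : Rn N → ℝ // MemLp g (expo p) ∧ HasWeakDirDeriv u v g}, ∫⁻ x, ‖g.1 x‖ₑ ^ p

/-- `‖Du‖_{L^p}^p`: for `p > 1` the integral of `|Du|^p`, for `p = 1` the total variation of
`Du`; the value is `∞` when `Du` is not in `L^p` (respectively, not a finite measure). -/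
def gradEnergy (p : ℝ) (u : Rn N → ℝ) : ℝ≥0∞ :=
  if p = 1 then totalVariation u
  else ⨅ G : {G : Rn N → Rn N // MemLp G (expo p) ∧ HasWeakGradient u G}, ∫⁻ x, ‖G.1 x‖ₑ ^ p

/-- The space `W^{1,p}(ℝ^N)` for `p > 1` and `BV(ℝ^N)` for `p = 1`. -/
def sobolevBV (N : ℕ) (p : ℝ) : Set (Rn N → ℝ) :=
  {u | MemLp u (expo p) ∧
    if p = 1 then totalVariation u < ⊤
    else ∃ G : Rn N → Rn N, MemLp G (expo p) ∧ HasWeakGradient u G}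

/-! ### Convergence of functionals on `L^p(ℝ^N)` -/

/-- `u_k → u` in `L^p(ℝ^N)`. -/
def TendstoLp (p : ℝ) (u : ℕ → Rn N → ℝ) (u₀ : Rn N → ℝ) : Prop :=
  Tendsto (fun k => eLpNorm (fun x => u k x - u₀ x) (expo p) volume) atTop (𝓝 0)

/-- `Γ`-convergence of `F_k` to `G` on `X ⊆ L^p(ℝ^N)` with respect to the `L^p` topology. -/
def GammaConverges (p : ℝ) (F : ℕ → (Rn N → ℝ) → ℝ≥0∞) (G : (Rn N → ℝ) → ℝ≥0∞)
    (X : Set (Rn N → ℝ)) : Prop :=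
  (∀ (u : ℕ → Rn N → ℝ) (u₀ : Rn N → ℝ), (∀ k, MemLp (u k) (expo p)) → u₀ ∈ X →
      TendstoLp p u u₀ → G u₀ ≤ liminf (fun k => F k (u k)) atTop) ∧
  (∀ u₀ ∈ X, ∃ u : ℕ → Rn N → ℝ, (∀ k, u k ∈ X) ∧ TendstoLp p u u₀ ∧
      limsup (fun k => F k (u k)) atTop ≤ G u₀)

/-- Coerciveness of `(F_k)` on `X ⊆ L^p(ℝ^N)`: an `L^p` limit of functions along which
`liminf F_k` is finite belongs to `X`. -/
def Coercive (p : ℝ) (F : ℕ → (Rn N → ℝ) → ℝ≥0∞) (X : Set (Rn N → ℝ)) : Prop :=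
  ∀ (u : ℕ → Rn N → ℝ) (u₀ : Rn N → ℝ), (∀ k, MemLp (u k) (expo p)) → MemLp u₀ (expo p) →
    TendstoLp p u u₀ → liminf (fun k => F k (u k)) atTop < ⊤ → u₀ ∈ X

/-! ### The kernels and the energies -/

/-- `K_b(x) = b^N K(b x)`. -/
def rescaledKernel (K : Rn N → ℝ≥0∞) (b : ℝ) (x : Rn N) : ℝ≥0∞ :=
  ENNReal.ofReal (b ^ N) * K (b • x)

/-- `b^p ∬ |u(x) - u(y)|^p K_b(x - y) dx dy`, with `b` in the place of `β(t)`. -/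
def nonlocalEnergy (p : ℝ) (K : Rn N → ℝ≥0∞) (b : ℝ) (u : Rn N → ℝ) : ℝ≥0∞ :=
  ENNReal.ofReal (b ^ p) *
    ∫⁻ y, ∫⁻ x, ‖u x - u y‖ₑ ^ p * rescaledKernel K b (x - y)

/-- The moment `‖ |·|^p K ‖_{L^1}`. -/
def moment (p : ℝ) (K : Rn N → ℝ≥0∞) : ℝ≥0∞ :=
  ∫⁻ x, ENNReal.ofReal (‖x‖ ^ p) * K x

/-- The angular density
`θ_{K,p}(σ) = (∫_0^∞ r^{N+p-1} K(r σ) dr) / ‖ |·|^p K ‖_{L^1}` on the unit sphere. -/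
def theta (p : ℝ) (K : Rn N → ℝ≥0∞) (σ : Metric.sphere (0 : Rn N) 1) : ℝ≥0∞ :=
  (∫⁻ r in Ioi (0 : ℝ), ENNReal.ofReal (r ^ ((N : ℝ) + p - 1)) * K (r • (σ : Rn N)))
    / moment p K

/-- `∫_{S^{N-1}} ‖σ · Du‖_{L^p}^p θ_{K,p}(σ) dH^{N-1}(σ)`; the surface measure of the sphere is
the one of Mathlib, normalised by polar coordinates. -/
def anisotropicEnergy (p : ℝ) (K : Rn N → ℝ≥0∞) (u : Rn N → ℝ) : ℝ≥0∞ :=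
  ∫⁻ σ : Metric.sphere (0 : Rn N) 1, dirEnergy p u (σ : Rn N) * theta p K σ
    ∂(volume : Measure (Rn N)).toSphere

/-- The mean value of `|σ · e|^p` over `σ ∈ S^{N-1}`, for a unit vector `e`. -/
def radialConstant (N : ℕ) (p : ℝ) : ℝ :=
  Real.Gamma (N / 2) * Real.Gamma ((p + 1) / 2) /
    (Real.sqrt Real.pi * Real.Gamma ((N + p) / 2))

/-- `K` is radially symmetric: up to a null set it is a function of `|x|`. -/
def IsRadial (K : Rn N → ℝ≥0∞) : Prop :=
  ∃ k : ℝ → ℝ≥0∞, ∀ᵐ x : Rn N, K x = k ‖x‖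

/-- The family `(F_t)_{t ∈ (0,1)}` converges to `G` as `t → 0⁺` on the space
`W^{1,p}(ℝ^N)` (`BV(ℝ^N)` if `p = 1`) pointwise and in the `Γ`-sense with respect to the `L^p`
topology, and both `(F_t)` and `G` are coercive on that space. -/
def ConvergesWithCoercivity (p : ℝ) (F : ℝ → (Rn N → ℝ) → ℝ≥0∞) (G : (Rn N → ℝ) → ℝ≥0∞) : Prop :=
  (∀ u ∈ sobolevBV N p, Tendsto (fun t => F t u) (𝓝[>] 0) (𝓝 (G u))) ∧
  (∀ t : ℕ → ℝ, (∀ k, t k ∈ Ioo (0 : ℝ) 1) → Tendsto t atTop (𝓝 0) →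
    GammaConverges p (fun k => F (t k)) G (sobolevBV N p) ∧
    Coercive p (fun k => F (t k)) (sobolevBV N p)) ∧
  Coercive p (fun _ => G) (sobolevBV N p)

end NonlocalBBM

end

namespace NonlocalBBM

/-! ### Powers of `L^p` norms -/

/-! Substituting `w = b (x - y)` turns the nonlocal energy into an average of directional difference
quotients, `F = ∫ D_b u(w) K(w) dw` with `D_b u(w) = ‖b (u(· + w/b) - u)‖_p^p`
(`nonlocalEnergy_eq_lintegral`). Everything then reduces to one direction `w` at a time, and to two
facts: `D_b u(w) ≤ ‖w · Du‖_p^p` for every `b > 0` (`diffQuotient_le_dirEnergy`), and `‖w · Du‖_p^p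
≤ liminf D_{b_k} u_k(w)` whenever `u_k → u` in `L^p` and `b_k → ∞`
(`dirEnergy_le_liminf_diffQuotient`).

Put `E(u) = ∫ ‖w · Du‖_p^p K(w) dw`. The first fact gives `F_t ≤ E` for every `t`, so constant
sequences are recovery sequences. The second, with Fatou's lemma in `w`, gives the liminf
inequality. Together they give pointwise convergence. Polar coordinates and `p`-homogeneity in `w`
identify `E` with `G` (`moment_mul_anisotropicEnergy`).

Both facts are dual statements. For `p = 1` they are tested against functions bounded by `1`; for `p
> 1` a functional on test functions that is bounded in `L^q` is represented by a function in `L^p`,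
via a signed measure and its Radon-Nikodym density. The upper bound uses that `φ - φ(· - v)` is the
derivative along `v` of the average of `φ` over segments, and such averages increase neither the sup
norm nor the `L^q` norm.

Coercivity: if `E(u) < ∞`, then `‖w · Du‖_p` is finite for a.e. `w` with `K(w) ≠ 0`. The directions
of finite energy form a linear subspace, and a proper subspace is null, so all directions are
finite.

For radial `K`, rotation invariance gives `∫ |a · w|^p K(w) dw = c |a|^p M`, and comparison with a
Gaussian computes `c`. Tonelli's theorem yields the claim when `Du` is a function; the `BV` case
follows by mollification. -/

theorem eLpNorm_rpow_eq_lintegral {α F : Type*} [MeasurableSpace α] [NormedAddCommGroup F]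
    {μ : Measure α} {p : ℝ} (hp : 0 < p) (f : α → F) :
    eLpNorm f (ENNReal.ofReal p) μ ^ p = ∫⁻ x, ‖f x‖ₑ ^ p ∂μ := by
  rw [eLpNorm_eq_lintegral_rpow_enorm_toReal (by simpa using hp) ENNReal.ofReal_ne_top,
    ENNReal.toReal_ofReal hp.le, ← ENNReal.rpow_mul, one_div, inv_mul_cancel₀ hp.ne',
    ENNReal.rpow_one]

theorem eLpNorm_eq_lintegral_rpow {α F : Type*} [MeasurableSpace α] [NormedAddCommGroup F]
    {μ : Measure α} {p : ℝ} (hp : 0 < p) (f : α → F) :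
    eLpNorm f (ENNReal.ofReal p) μ = (∫⁻ x, ‖f x‖ₑ ^ p ∂μ) ^ (1 / p) := by
  rw [eLpNorm_eq_lintegral_rpow_enorm_toReal (by simpa using hp) ENNReal.ofReal_ne_top,
    ENNReal.toReal_ofReal hp.le]

theorem tendsto_eLpNorm_sub_of_dominated {α : Type*} [MeasurableSpace α] {μ : Measure α} {q : ℝ}
    (hq : 0 < q) {f : ℕ → α → ℝ} {g G : α → ℝ} (hf : ∀ n, Measurable (f n)) (hg : Measurable g)
    (hG : MemLp G (ENNReal.ofReal q) μ) (hfG : ∀ n x, |f n x| ≤ |G x|)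
    (hlim : ∀ x, Tendsto (fun n => f n x) atTop (𝓝 (g x))) :
    Tendsto (fun n => eLpNorm (f n - g) (ENNReal.ofReal q) μ) atTop (𝓝 0) := by
  simp_rw [eLpNorm_eq_lintegral_rpow hq]
  have hgG : ∀ x, |g x| ≤ |G x| := fun x =>
    le_of_tendsto (hlim x).abs (Eventually.of_forall fun n => hfG n x)
  have key : Tendsto (fun n => ∫⁻ x, ‖(f n - g) x‖ₑ ^ q ∂μ) atTop (𝓝 (∫⁻ x, 0 ∂μ)) := by
    refine tendsto_lintegral_of_dominated_convergence (fun x => ‖((2 : ℝ) • G) x‖ₑ ^ q) ?_ ?_ ?_ ?_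
    · intro n
      exact (((hf n).sub hg).enorm).pow_const q
    · intro n
      refine Eventually.of_forall fun x => ?_
      refine ENNReal.rpow_le_rpow ?_ hq.le
      rw [enorm_le_iff_norm_le]
      simp only [Pi.sub_apply, Pi.smul_apply, smul_eq_mul, norm_mul, Real.norm_eq_abs]
      have := abs_sub (f n x) (g x)
      rw [abs_two]
      linarith [hfG n x, hgG x]
    · rw [← eLpNorm_rpow_eq_lintegral hq]
      exact (ENNReal.rpow_lt_top_of_nonneg hq.le (hG.const_smul (2 : ℝ)).eLpNorm_ne_top).ne
    · refine Eventually.of_forall fun x => ?_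
      have h1 : Tendsto (fun n => ‖(f n - g) x‖ₑ) atTop (𝓝 0) := by
        have h2 : Tendsto (fun n => (f n - g) x) atTop (𝓝 (g x - g x)) :=
          (hlim x).sub tendsto_const_nhds
        rw [sub_self] at h2
        simpa using h2.enorm
      have := (ENNReal.continuous_rpow_const (y := q)).tendsto 0 |>.comp h1
      rw [ENNReal.zero_rpow_of_pos hq] at this
      exact this
  rw [lintegral_zero] at key
  have := (ENNReal.continuous_rpow_const (y := 1 / q)).tendsto 0 |>.comp key
  rw [ENNReal.zero_rpow_of_pos (by positivity)] at this
  exact this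

/-! ### Bounded linear functionals on `L^q` -/

/-- `S` is a linear functional on `L^q` (given on functions), with norm at most `C`. -/
structure IsLqFunctional {α : Type*} [MeasurableSpace α] (μ : Measure α) (q : ℝ)
    (S : (α → ℝ) → ℝ) (C : ℝ≥0∞) : Prop where
  add : ∀ f g, MemLp f (ENNReal.ofReal q) μ → MemLp g (ENNReal.ofReal q) μ →
    S (f + g) = S f + S g
  smul : ∀ (c : ℝ) f, MemLp f (ENNReal.ofReal q) μ → S (c • f) = c * S f
  bound : ∀ f, MemLp f (ENNReal.ofReal q) μ → ‖S f‖ₑ ≤ C * eLpNorm f (ENNReal.ofReal q) μ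

namespace IsLqFunctional

variable {α : Type*} [MeasurableSpace α] {μ : Measure α} {q : ℝ} {S : (α → ℝ) → ℝ} {C : ℝ≥0∞}

theorem sub (hS : IsLqFunctional μ q S C) {f g : α → ℝ} (hf : MemLp f (ENNReal.ofReal q) μ)
    (hg : MemLp g (ENNReal.ofReal q) μ) : S (f - g) = S f - S g := by
  have h := hS.add f ((-1 : ℝ) • g) hf (hg.const_smul _)
  rw [hS.smul _ _ hg] at h
  have e : f - g = f + (-1 : ℝ) • g := by ext x; simp; ring
  rw [e, h]; ring

theorem tendsto (hS : IsLqFunctional μ q S C) (hC : C ≠ ⊤) {f : ℕ → α → ℝ} {g : α → ℝ}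
    (hf : ∀ n, MemLp (f n) (ENNReal.ofReal q) μ) (hg : MemLp g (ENNReal.ofReal q) μ)
    (h : Tendsto (fun n => eLpNorm (f n - g) (ENNReal.ofReal q) μ) atTop (𝓝 0)) :
    Tendsto (fun n => S (f n)) atTop (𝓝 (S g)) := by
  rw [tendsto_iff_edist_tendsto_0]
  have h1 : Tendsto (fun n => C * eLpNorm (f n - g) (ENNReal.ofReal q) μ) atTop (𝓝 (C * 0)) :=
    ENNReal.Tendsto.const_mul h (Or.inr hC)
  rw [mul_zero] at h1
  refine tendsto_of_tendsto_of_tendsto_of_le_of_le tendsto_const_nhds h1 (fun _ => zero_le) ?_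
  intro n
  dsimp only
  rw [edist_eq_enorm_sub, ← hS.sub (hf n) hg]
  exact hS.bound _ ((hf n).sub hg)

/-- The signed measure `A ↦ S (h 1_A)`. -/
theorem exists_signedMeasure (hS : IsLqFunctional μ q S C) (hC : C ≠ ⊤) (hq : 0 < q) {h : α → ℝ}
    (hh : MemLp h (ENNReal.ofReal q) μ) :
    ∃ ν : SignedMeasure α, ∀ A, MeasurableSet A → ν A = S (A.indicator h) := by
  classical
  have hS0 : S 0 = 0 := by
    have := hS.smul 0 0 MemLp.zero
    simpa using this
  have hI : ∀ A, MeasurableSet A → MemLp (A.indicator h) (ENNReal.ofReal q) μ :=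
    fun A hA => hh.indicator hA
  refine ⟨⟨fun A => if MeasurableSet A then S (A.indicator h) else 0, ?_, ?_, ?_⟩, ?_⟩
  · simp only [MeasurableSet.empty, if_true, indicator_empty]
    exact hS0
  · intro A hA
    simp [hA]
  · intro A hA hdis
    have hU : MeasurableSet (⋃ i, A i) := MeasurableSet.iUnion hA
    simp only [hA, hU, if_true]
    have hfin : ∀ s : Finset ℕ, ∑ i ∈ s, S ((A i).indicator h) =
        S ((⋃ i ∈ s, A i).indicator h) := by
      intro s
      induction s using Finset.induction_on with
      | empty =>
        rw [Finset.sum_empty, ← hS0]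
        congr 1
        ext x
        simp
      | insert a s ha ih =>
        rw [Finset.sum_insert ha, ih, Finset.set_biUnion_insert, ← hS.add _ _ (hI _ (hA a))
          (hI _ (Finset.measurableSet_biUnion s fun i _ => hA i)),
          indicator_union_of_disjoint]
        · rfl
        · rw [Set.disjoint_iUnion₂_right]
          intro i hi
          exact hdis (fun e => ha (e ▸ hi))
    unfold HasSum
    simp only [SummationFilter.unconditional_filter]
    simp_rw [hfin]
    rw [tendsto_iff_edist_tendsto_0]
    -- Countable additivity: the error after finitely many pieces is `S` applied to `h` on the
    -- remaining pieces, at most `C` times the `1/q`-th power of a tail of this convergent series of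
    -- masses.
    have hmass : ∑' i, ∫⁻ x in A i, ‖h x‖ₑ ^ q ∂μ ≠ ⊤ := by
      rw [← lintegral_iUnion hA hdis]
      refine ne_top_of_le_ne_top ?_ (setLIntegral_le_lintegral _ _)
      rw [← eLpNorm_rpow_eq_lintegral hq]
      exact (ENNReal.rpow_lt_top_of_nonneg hq.le hh.eLpNorm_ne_top).ne
    have ht := ENNReal.tendsto_tsum_compl_atTop_zero hmass
    have ht2 := (ENNReal.continuous_rpow_const (y := 1 / q)).tendsto 0 |>.comp ht
    rw [ENNReal.zero_rpow_of_pos (by positivity)] at ht2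
    have ht3 := ENNReal.Tendsto.const_mul ht2 (Or.inr hC)
    rw [mul_zero] at ht3
    refine tendsto_of_tendsto_of_tendsto_of_le_of_le tendsto_const_nhds ht3
      (fun _ => zero_le) ?_
    intro s
    dsimp only
    have hms : MeasurableSet (⋃ i ∈ s, A i) := Finset.measurableSet_biUnion s fun i _ => hA i
    rw [edist_comm, edist_eq_enorm_sub, ← hS.sub (hI _ hU) (hI _ hms)]
    refine (hS.bound _ ((hI _ hU).sub (hI _ hms))).trans ?_
    gcongr
    rw [eLpNorm_eq_lintegral_rpow hq]
    simp only [Function.comp]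
    gcongr
    have hsub : (⋃ i, A i).indicator h - (⋃ i ∈ s, A i).indicator h =
        (⋃ i : {i // i ∉ s}, A i).indicator h := by
      ext x
      simp only [Pi.sub_apply, indicator, mem_iUnion]
      by_cases hx : ∃ i, x ∈ A i
      · obtain ⟨i, hi⟩ := hx
        have huniq : ∀ j, x ∈ A j → j = i := by
          intro j hj
          by_contra hne
          exact (Set.disjoint_left.1 (hdis hne)) hj hi
        by_cases his : i ∈ s
        · rw [if_pos ⟨i, hi⟩, if_pos ⟨i, his, hi⟩, if_neg]
          · simp
          · rintro ⟨⟨j, hj⟩, hxj⟩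
            exact hj (huniq j hxj ▸ his)
        · rw [if_pos ⟨i, hi⟩, if_neg, if_pos ⟨⟨i, his⟩, hi⟩]
          · simp
          · rintro ⟨j, hj, hxj⟩
            exact his (huniq j hxj ▸ hj)
      · rw [if_neg hx, if_neg (fun ⟨i, _, hi⟩ => hx ⟨i, hi⟩), if_neg (fun ⟨i, hi⟩ => hx ⟨i, hi⟩)]
        simp
    rw [hsub]
    have hind : ∀ x, ‖(⋃ i : {i // i ∉ s}, A i).indicator h x‖ₑ ^ q =
        (⋃ i : {i // i ∉ s}, A i).indicator (fun x => ‖h x‖ₑ ^ q) x := by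
      intro x
      by_cases hx : x ∈ ⋃ i : {i // i ∉ s}, A i
      · simp only [indicator_of_mem hx]
      · simp only [indicator_of_notMem hx, enorm_zero, ENNReal.zero_rpow_of_pos hq]
    simp_rw [hind]
    rw [lintegral_indicator (MeasurableSet.iUnion (f := fun i : {i // i ∉ s} => A i) fun i => hA i)]
    exact lintegral_iUnion_le _ _
  · intro A hA
    change (if MeasurableSet A then S (A.indicator h) else 0) = _
    rw [if_pos hA]

end IsLqFunctional

namespace IsLqFunctional

variable {α : Type*} [MeasurableSpace α] {μ : Measure α} {p q : ℝ} {S : (α → ℝ) → ℝ} {C : ℝ≥0∞}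

/-- The identity `S f = ∫ g f` survives dominated pointwise limits. It is used twice: to pass from
simple multiples of a weight to functions bounded by that weight, and from truncations to all of
`L^q`. -/
theorem integral_eq_of_dominated (hS : IsLqFunctional μ q S C) (hC : C ≠ ⊤) (hq : 0 < q)
    {g G f : α → ℝ} (hg : Measurable g) (hG : MemLp G (ENNReal.ofReal q) μ)
    (hgG : Integrable (fun x => g x * G x) μ) {F : ℕ → α → ℝ} (hF : ∀ n, Measurable (F n))
    (hf : Measurable f) (hFG : ∀ n x, |F n x| ≤ |G x|)
    (hlim : ∀ x, Tendsto (fun n => F n x) atTop (𝓝 (f x)))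
    (hP : ∀ n, S (F n) = ∫ x, g x * F n x ∂μ) : S f = ∫ x, g x * f x ∂μ := by
  have hfG : ∀ x, |f x| ≤ |G x| := fun x =>
    le_of_tendsto (hlim x).abs (Eventually.of_forall fun n => hFG n x)
  have hFm : ∀ n, MemLp (F n) (ENNReal.ofReal q) μ := fun n =>
    hG.mono (hF n).aestronglyMeasurable (Eventually.of_forall fun x => hFG n x)
  have hfm : MemLp f (ENNReal.ofReal q) μ :=
    hG.mono hf.aestronglyMeasurable (Eventually.of_forall fun x => hfG x)
  have h1 := hS.tendsto hC hFm hfm (tendsto_eLpNorm_sub_of_dominated hq hF hf hG hFG hlim)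
  have h2 : Tendsto (fun n => ∫ x, g x * F n x ∂μ) atTop (𝓝 (∫ x, g x * f x ∂μ)) := by
    refine tendsto_integral_of_dominated_convergence (fun x => ‖g x * G x‖) ?_ hgG.norm ?_ ?_
    · exact fun n => (hg.mul (hF n)).aestronglyMeasurable
    · intro n
      refine Eventually.of_forall fun x => ?_
      simp only [norm_mul, Real.norm_eq_abs]
      exact mul_le_mul_of_nonneg_left (hFG n x) (abs_nonneg _)
    · exact Eventually.of_forall fun x => (hlim x).const_mul _
  simp_rw [hP] at h1
  exact tendsto_nhds_unique h1 h2

/-- Division by `I ^ (1 / q)`, which requires `I` finite; hence the truncation when the norm of the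
representing function is estimated. -/
theorem le_rpow_of_le_mul_rpow (hpq : p.HolderConjugate q) {I C : ℝ≥0∞} (hI : I ≠ ⊤)
    (h : I ≤ C * I ^ (1 / q)) : I ≤ C ^ p := by
  rcases eq_or_ne I 0 with rfl | h0
  · exact zero_le
  have h1 : I ^ (1 / p) * I ^ (1 / q) ≤ C * I ^ (1 / q) := by
    rw [← ENNReal.rpow_add _ _ h0 hI]
    have : 1 / p + 1 / q = 1 := by simpa [one_div] using hpq.inv_add_inv_eq_one
    rw [this, ENNReal.rpow_one]
    exact h
  have h2 : I ^ (1 / p) ≤ C := by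
    refine (ENNReal.mul_le_mul_iff_left ?_ ?_).1 h1
    · exact (ENNReal.rpow_pos (pos_iff_ne_zero.2 h0) hI).ne'
    · exact ENNReal.rpow_ne_top_of_nonneg (by have := hpq.symm.pos; positivity) hI
  calc I = (I ^ (1 / p)) ^ p := by
        rw [← ENNReal.rpow_mul, one_div, inv_mul_cancel₀ hpq.pos.ne', ENNReal.rpow_one]
    _ ≤ C ^ p := ENNReal.rpow_le_rpow h2 hpq.nonneg

/-- A positive weight `h` in `L^q` replaces an exhaustion by sets of finite measure: `h 1_A` lies in
`L^q` for every measurable `A`, so `A ↦ S (h 1_A)` is a signed measure on the whole space. -/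
theorem exists_pos_memLp (μ : Measure α) [SigmaFinite μ] (hq : 0 < q) :
    ∃ h : α → ℝ, Measurable h ∧ (∀ x, 0 < h x) ∧ MemLp h (ENNReal.ofReal q) μ := by
  obtain ⟨w, hw0, hwm, hw⟩ := exists_pos_lintegral_lt_of_sigmaFinite μ one_ne_zero
  have hm : Measurable fun x => ((w x : ℝ)) ^ (1 / q) := (measurable_coe_nnreal_real.comp hwm).pow_const _
  refine ⟨fun x => (w x : ℝ) ^ (1 / q), hm, fun x => Real.rpow_pos_of_pos (hw0 x) _,
    hm.aestronglyMeasurable, ?_⟩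
  rw [eLpNorm_eq_lintegral_rpow hq]
  refine ENNReal.rpow_lt_top_of_nonneg (by positivity) ?_
  refine (lt_of_eq_of_lt (lintegral_congr fun x => ?_) (hw.trans ENNReal.one_lt_top)).ne
  rw [Real.enorm_eq_ofReal (by positivity), ENNReal.ofReal_rpow_of_nonneg (by positivity) hq.le,
    ← Real.rpow_mul (by positivity), one_div, inv_mul_cancel₀ hq.ne', Real.rpow_one,
    ENNReal.ofReal_coe_nnreal]

/-- If `k` is the density of `A ↦ S (h 1_A)`, the representing function must be `k / h`; linearity
extends this from indicators to simple functions times `h`. -/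
theorem integral_eq_of_simple (hS : IsLqFunctional μ q S C) {h k : α → ℝ}
    (hhp : ∀ x, 0 < h x) (hhL : MemLp h (ENNReal.ofReal q) μ) (hk : Integrable k μ)
    (hkS : ∀ A, MeasurableSet A → ∫ x in A, k x ∂μ = S (A.indicator h)) (s : SimpleFunc α ℝ) :
    S (fun x => s x * h x) = ∫ x, k x / h x * (s x * h x) ∂μ := by
  have hred : ∀ s : SimpleFunc α ℝ,
      ∫ x, k x / h x * (s x * h x) ∂μ = ∫ x, s x * k x ∂μ := fun s => by
    congr 1 with x
    have := (hhp x).ne'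
    field_simp
  have hmem : ∀ s : SimpleFunc α ℝ, MemLp (fun x => s x * h x) (ENNReal.ofReal q) μ := fun s => by
    obtain ⟨B, hB⟩ := s.exists_forall_norm_le
    refine hhL.of_le_mul (c := B) (s.aestronglyMeasurable.mul hhL.1)
      (Eventually.of_forall fun x => ?_)
    rw [norm_mul]
    exact mul_le_mul_of_nonneg_right (hB x) (norm_nonneg _)
  have hint : ∀ s : SimpleFunc α ℝ, Integrable (fun x => s x * k x) μ := fun s => by
    obtain ⟨B, hB⟩ := s.exists_forall_norm_le
    exact hk.bdd_mul s.aestronglyMeasurable (Eventually.of_forall hB)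
  rw [hred]
  induction s using SimpleFunc.induction with
  | const c hA =>
    rename_i A
    have e1 : (fun x => (SimpleFunc.piecewise A hA (SimpleFunc.const α c) (SimpleFunc.const α 0)) x
        * h x) = c • A.indicator h := by
      ext x
      by_cases hx : x ∈ A <;> simp [hx]
    have e2 : (fun x => (SimpleFunc.piecewise A hA (SimpleFunc.const α c) (SimpleFunc.const α 0)) x
        * k x) = fun x => c * A.indicator k x := by
      ext x
      by_cases hx : x ∈ A <;> simp [hx]
    rw [e1, e2, hS.smul _ _ (hhL.indicator hA), integral_const_mul, integral_indicator hA, hkS A hA]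
  | add hdis h1 h2 =>
    rename_i f g
    have e1 : (fun x => (f + g) x * h x) = (fun x => f x * h x) + fun x => g x * h x := by
      ext x
      simp [add_mul]
    rw [e1, hS.add _ _ (hmem f) (hmem g), h1, h2, ← integral_add (hint f) (hint g)]
    congr 1 with x
    simp [add_mul]

/-- **Riesz representation** of the dual of `L^q`, `1 < q < ∞`. -/
theorem exists_representation [SigmaFinite μ] (hpq : p.HolderConjugate q)
    (hS : IsLqFunctional μ q S C) (hC : C ≠ ⊤) :
    ∃ g : α → ℝ, Measurable g ∧ ∫⁻ x, ‖g x‖ₑ ^ p ∂μ ≤ C ^ p ∧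
      ∀ f, Measurable f → MemLp f (ENNReal.ofReal q) μ → S f = ∫ x, g x * f x ∂μ := by
  have hq : 0 < q := hpq.symm.pos
  have hp : 0 < p := hpq.pos
  obtain ⟨h, hhm, hhp, hhL⟩ := exists_pos_memLp μ hq
  obtain ⟨ν, hν⟩ := hS.exists_signedMeasure hC hq hhL
  have hac : ν ≪ᵥ μ.toENNRealVectorMeasure := by
    refine VectorMeasure.AbsolutelyContinuous.mk fun A hA h0 => ?_
    rw [Measure.toENNRealVectorMeasure_apply_measurable hA] at h0
    rw [hν A hA]
    have h1 := hS.bound _ (hhL.indicator hA)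
    have h2 : eLpNorm (A.indicator h) (ENNReal.ofReal q) μ = 0 := by
      rw [eLpNorm_congr_ae (g := 0), eLpNorm_zero]
      have : ∀ᵐ x ∂μ, x ∉ A := by simpa [ae_iff] using h0
      filter_upwards [this] with x hx
      simp [hx]
    rw [h2, mul_zero] at h1
    simpa using h1
  set k := ν.rnDeriv μ with hkdef
  have hkm : Measurable k := SignedMeasure.measurable_rnDeriv ν μ
  have hk : Integrable k μ := SignedMeasure.integrable_rnDeriv ν μ
  have hkS : ∀ A, MeasurableSet A → ∫ x in A, k x ∂μ = S (A.indicator h) := fun A hA => by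
    rw [← hν A hA, ← withDensityᵥ_apply hk hA, SignedMeasure.withDensityᵥ_rnDeriv_eq ν μ hac]
  have hgm : Measurable fun x => k x / h x := hkm.div hhm
  -- functions dominated by a multiple of `h`
  have hbdd : ∀ (f : α → ℝ) (n : ℕ), Measurable f → (∀ x, |f x| ≤ n * h x) →
      S f = ∫ x, k x / h x * f x ∂μ := by
    intro f n hf hfn
    have hfh : Measurable fun x => f x / h x := hf.div hhm
    -- Approximate `f / h`, bounded by `n`, by simple functions. The factor `2` is the loss in the
    -- bound for `approxOn`.
    refine hS.integral_eq_of_dominated hC hq (G := fun x => (2 * n : ℝ) * h x)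
      (F := fun j x => SimpleFunc.approxOn (fun x => f x / h x) hfh univ 0 (mem_univ _) j x * h x)
      hgm (hhL.const_mul _) ?_ ?_ hf ?_ ?_ ?_
    · refine (hk.const_mul (2 * n : ℝ)).congr (Eventually.of_forall fun x => ?_)
      have := (hhp x).ne'
      dsimp only
      field_simp
    · exact fun j => (SimpleFunc.measurable _).mul hhm
    · intro j x
      have h1 := SimpleFunc.norm_approxOn_zero_le hfh (mem_univ (0 : ℝ)) x j
      have h2 : ‖f x / h x‖ ≤ n := by
        rw [norm_div, Real.norm_of_nonneg (hhp x).le, div_le_iff₀ (hhp x)]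
        exact hfn x
      rw [abs_mul, abs_mul, abs_of_nonneg (by positivity : (0 : ℝ) ≤ 2 * n)]
      refine mul_le_mul_of_nonneg_right ?_ (abs_nonneg _)
      rw [Real.norm_eq_abs] at h1
      linarith
    · intro x
      have h1 := (SimpleFunc.tendsto_approxOn hfh (mem_univ (0 : ℝ)) (x := x) (by simp)).mul_const
        (h x)
      rwa [div_mul_cancel₀ _ (hhp x).ne'] at h1
    · intro j
      exact hS.integral_eq_of_simple hhp hhL hk hkS _
  have hgp : ∫⁻ x, ‖k x / h x‖ₑ ^ p ∂μ ≤ C ^ p := by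
    set g := fun x => k x / h x with hgdef
    -- Extremal function of Hölder's inequality: `f = sign(g) |g|^(p-1)` satisfies `g f = |f|^q =
    -- |g|^p`. Cutting it off to `A n` makes it at most `n h`, where the representation is already
    -- available.
    set A : ℕ → Set α := fun n => {x | |g x| ^ (p - 1) ≤ n * h x} with hAdef
    have hAm : ∀ n, MeasurableSet (A n) := fun n =>
      measurableSet_le (hgm.abs.pow_const _) (hhm.const_mul _)
    have hAn : ∀ n, ∫⁻ x in A n, ‖g x‖ₑ ^ p ∂μ ≤ C ^ p := by
      intro n
      set f : α → ℝ := (A n).indicator fun x => SignType.sign (g x) * |g x| ^ (p - 1) with hfdef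
      have hsm : Measurable fun x => ((SignType.sign (g x) : SignType) : ℝ) := by
        have : (fun x => ((SignType.sign (g x) : SignType) : ℝ)) =
            fun x => if 0 < g x then 1 else if g x < 0 then -1 else 0 := by
          ext x
          simp only [sign_apply]
          split_ifs <;> simp
        rw [this]
        refine Measurable.ite (measurableSet_lt measurable_const hgm) measurable_const ?_
        exact Measurable.ite (measurableSet_lt hgm measurable_const) measurable_const
          measurable_const
      have hfm : Measurable f := (hsm.mul (hgm.abs.pow_const _)).indicator (hAm n)
      have hsabs : ∀ t : ℝ, |((SignType.sign t : SignType) : ℝ)| ≤ 1 := by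
        intro t
        rcases lt_trichotomy t 0 with ht | ht | ht <;> simp [ht]
      have hfh : ∀ x, |f x| ≤ n * h x := by
        intro x
        by_cases hx : x ∈ A n
        · rw [hfdef, indicator_of_mem hx, abs_mul, abs_of_nonneg (by positivity : 0 ≤ |g x| ^ (p - 1))]
          exact (mul_le_of_le_one_left (by positivity) (hsabs _)).trans hx
        · rw [hfdef, indicator_of_notMem hx, abs_zero]
          have := hhp x
          positivity
      have hfL : MemLp f (ENNReal.ofReal q) μ :=
        hhL.of_le_mul hfm.aestronglyMeasurable (c := n) (Eventually.of_forall fun x => by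
          rw [Real.norm_eq_abs, Real.norm_of_nonneg (hhp x).le]; exact hfh x)
      have hgf : ∀ x, g x * f x = (A n).indicator (fun x => |g x| ^ p) x := by
        intro x
        by_cases hx : x ∈ A n
        · rw [hfdef, indicator_of_mem hx, indicator_of_mem hx, ← mul_assoc, mul_comm (g x),
            sign_mul_self]
          rcases eq_or_ne (g x) 0 with h0 | h0
          · simp [h0, Real.zero_rpow hp.ne']
          · rw [Real.rpow_sub_one (abs_pos.2 h0).ne']
            have := (abs_pos.2 h0).ne'
            field_simp
        · rw [hfdef, indicator_of_notMem hx, indicator_of_notMem hx, mul_zero]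
      have hfq : ∀ x, ‖f x‖ₑ ^ q = (A n).indicator (fun x => ‖g x‖ₑ ^ p) x := by
        intro x
        by_cases hx : x ∈ A n
        · rw [hfdef, indicator_of_mem hx, indicator_of_mem hx]
          rcases eq_or_ne (g x) 0 with h0 | h0
          · simp [h0, hq, hp]
          · have h1 : ‖((SignType.sign (g x) : SignType) : ℝ) * |g x| ^ (p - 1)‖ₑ
                = ENNReal.ofReal (|g x| ^ (p - 1)) := by
              rw [← ofReal_norm, norm_mul, Real.norm_of_nonneg (by positivity : 0 ≤ |g x| ^ (p - 1))]
              rcases lt_or_gt_of_ne h0 with ht | ht <;> simp [ht]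
            rw [h1, ← ofReal_norm, ENNReal.ofReal_rpow_of_nonneg (by positivity) hq.le,
              ENNReal.ofReal_rpow_of_nonneg (by positivity) hp.le, ← Real.rpow_mul (abs_nonneg _),
              hpq.sub_one_mul_conj, Real.norm_eq_abs]
        · rw [hfdef, indicator_of_notMem hx, indicator_of_notMem hx]
          simp [hq]
      have hI : ∫⁻ x, ‖f x‖ₑ ^ q ∂μ = ∫⁻ x in A n, ‖g x‖ₑ ^ p ∂μ := by
        simp_rw [hfq]
        rw [lintegral_indicator (hAm n)]
      have hfin : ∫⁻ x in A n, ‖g x‖ₑ ^ p ∂μ ≠ ⊤ := by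
        rw [← hI, ← eLpNorm_rpow_eq_lintegral hq]
        exact (ENNReal.rpow_lt_top_of_nonneg hq.le hfL.eLpNorm_ne_top).ne
      refine le_rpow_of_le_mul_rpow hpq hfin ?_
      have hb := hS.bound f hfL
      rw [eLpNorm_eq_lintegral_rpow hq, hI, hbdd f n hfm hfh] at hb
      refine le_trans (le_of_eq ?_) hb
      rw [Real.enorm_eq_ofReal_abs, abs_of_nonneg, ofReal_integral_eq_lintegral_ofReal, ← hI]
      · refine lintegral_congr fun x => ?_
        rw [hfq, hgf]
        by_cases hx : x ∈ A n
        · rw [indicator_of_mem hx, indicator_of_mem hx, ← ofReal_norm,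
            ENNReal.ofReal_rpow_of_nonneg (by positivity) hp.le, Real.norm_eq_abs]
        · simp [hx]
      · refine ⟨(hgm.mul hfm).aestronglyMeasurable, ?_⟩
        rw [HasFiniteIntegral]
        refine lt_of_eq_of_lt ?_ hfin.lt_top
        rw [← hI]
        refine lintegral_congr fun x => ?_
        rw [hgf, hfq]
        by_cases hx : x ∈ A n
        · rw [indicator_of_mem hx, indicator_of_mem hx, Real.enorm_rpow_of_nonneg (abs_nonneg _) hp.le]
          simp
        · simp [hx]
      · refine Eventually.of_forall fun x => ?_
        simp only [Pi.zero_apply]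
        rw [hgf]
        exact indicator_nonneg (fun y _ => by positivity) x
      · refine integral_nonneg fun x => ?_
        simp only [Pi.zero_apply]
        rw [hgf]
        exact indicator_nonneg (fun y _ => by positivity) x
    -- As `h > 0`, the sets `A n` exhaust the space, so the uniform bound passes to the full
    -- integral.
    have hAmono : Monotone A := by
      intro m n hmn x hx
      refine le_trans (show |g x| ^ (p - 1) ≤ m * h x from hx) ?_
      have := hhp x
      gcongr
    have hAU : ⋃ n, A n = univ := by
      refine eq_univ_of_forall fun x => mem_iUnion.2 ?_
      obtain ⟨n, hn⟩ := exists_nat_ge (|g x| ^ (p - 1) / h x)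
      exact ⟨n, (div_le_iff₀ (hhp x)).1 hn⟩
    rw [← setLIntegral_univ, ← hAU, setLIntegral_iUnion_of_directed _ hAmono.directed_le]
    exact iSup_le hAn
  refine ⟨fun x => k x / h x, hgm, hgp, fun f hf hfL => ?_⟩
  -- With `g` in `L^p`, Hölder makes `g f` integrable for every `f` in `L^q`, and the truncations of
  -- `f` to `{|f| ≤ n h}` converge dominatedly.
  have hgL : MemLp (fun x => k x / h x) (ENNReal.ofReal p) μ := by
    refine ⟨hgm.aestronglyMeasurable, ?_⟩
    rw [eLpNorm_eq_lintegral_rpow hp]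
    exact ENNReal.rpow_lt_top_of_nonneg (by positivity)
      (ne_top_of_le_ne_top (ENNReal.rpow_ne_top_of_nonneg hp.le hC) hgp)
  have hconj : ENNReal.HolderConjugate (ENNReal.ofReal p) (ENNReal.ofReal q) :=
    hpq.ennrealOfReal
  have hAm : ∀ n : ℕ, MeasurableSet {x | |f x| ≤ n * h x} := fun n =>
    measurableSet_le hf.abs (hhm.const_mul _)
  refine hS.integral_eq_of_dominated hC hq (G := f)
    (F := fun n => {x | |f x| ≤ n * h x}.indicator f) hgm hfL (hgL.integrable_mul hfL)
    (fun n => hf.indicator (hAm n)) hf ?_ ?_ ?_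
  · intro n x
    exact norm_indicator_le_norm_self f x
  · intro x
    refine tendsto_const_nhds.congr' ?_
    obtain ⟨n, hn⟩ := exists_nat_ge (|f x| / h x)
    filter_upwards [eventually_ge_atTop n] with m hm
    refine (indicator_of_mem ?_ f).symm
    rw [mem_ofPred_eq, ← div_le_iff₀ (hhp x)]
    exact hn.trans (by exact_mod_cast hm)
  · intro n
    refine hbdd _ n (hf.indicator (hAm n)) fun x => ?_
    by_cases hx : x ∈ {x | |f x| ≤ n * h x}
    · rw [indicator_of_mem hx]
      exact hx
    · rw [indicator_of_notMem hx, abs_zero]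
      have := hhp x
      positivity
end IsLqFunctional

/-! ### Test functions -/

namespace IsTest

variable {N : ℕ} {F : Type*} [NormedAddCommGroup F] [NormedSpace ℝ F]

theorem continuous {φ : Rn N → F} (h : IsTest φ) : Continuous φ := h.1.continuous

theorem differentiable {φ : Rn N → F} (h : IsTest φ) : Differentiable ℝ φ :=
  h.1.differentiable (by simp)

theorem memLp {φ : Rn N → F} (h : IsTest φ) (p : ℝ≥0∞) : MemLp φ p :=
  h.continuous.memLp_of_hasCompactSupport h.2

theorem integrable {φ : Rn N → F} (h : IsTest φ) : Integrable φ :=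
  h.continuous.integrable_of_hasCompactSupport h.2

theorem fderiv_apply {φ : Rn N → F} (h : IsTest φ) (v : Rn N) :
    IsTest fun x => fderiv ℝ φ x v :=
  ⟨(h.1.fderiv_right (m := ∞) (by simp)).clm_apply contDiff_const, h.2.fderiv_apply ℝ v⟩

theorem add {φ ψ : Rn N → F} (h : IsTest φ) (h' : IsTest ψ) : IsTest (φ + ψ) :=
  ⟨h.1.add h'.1, h.2.add h'.2⟩

theorem const_smul {φ : Rn N → F} (h : IsTest φ) (c : ℝ) : IsTest (c • φ) :=
  ⟨h.1.const_smul c, h.2.smul_left (f := fun _ => c)⟩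

theorem neg {φ : Rn N → F} (h : IsTest φ) : IsTest (-φ) := by
  simpa using h.const_smul (-1)

theorem integrable_mul {φ : Rn N → ℝ} (h : IsTest φ) {u : Rn N → ℝ} (hu : LocallyIntegrable u) :
    Integrable fun x => u x * φ x := by
  simpa only [smul_eq_mul, mul_comm] using
    hu.integrable_smul_left_of_hasCompactSupport h.continuous h.2

end IsTest

/-- The linear space of test functions. -/
def testSpace (N : ℕ) : Submodule ℝ (Rn N → ℝ) where
  carrier := {φ | IsTest φ}
  add_mem' h h' := h.add h'
  zero_mem' := ⟨contDiff_const, HasCompactSupport.zero⟩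
  smul_mem' c _ h := h.const_smul c

/-- A linear functional on test functions that is bounded in the norm of `L^q` is represented by
a function in `L^p`. -/
theorem exists_representation_of_test_bound {N : ℕ} {p q : ℝ} (hpq : p.HolderConjugate q)
    {T : (Rn N → ℝ) → ℝ} {C : ℝ≥0∞} (hC : C ≠ ⊤)
    (hadd : ∀ φ ψ, IsTest φ → IsTest ψ → T (φ + ψ) = T φ + T ψ)
    (hsmul : ∀ (c : ℝ) φ, IsTest φ → T (c • φ) = c * T φ)
    (hbd : ∀ φ, IsTest φ → ‖T φ‖ₑ ≤ C * eLpNorm φ (ENNReal.ofReal q) volume) :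
    ∃ g : Rn N → ℝ, MemLp g (ENNReal.ofReal p) ∧ ∫⁻ x, ‖g x‖ₑ ^ p ≤ C ^ p ∧
      ∀ φ, IsTest φ → T φ = ∫ x, g x * φ x := by
  classical
  have hq1 : 1 < q := hpq.symm.lt
  have hp : 0 < p := hpq.pos
  have : Fact (1 ≤ ENNReal.ofReal q) := ⟨by simpa using hq1.le⟩
  let f : testSpace N →ₗ[ℝ] ℝ :=
    { toFun := fun φ => T φ.1
      map_add' := fun φ ψ => hadd _ _ φ.2 ψ.2
      map_smul' := fun c φ => hsmul c _ φ.2 }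
  let e : testSpace N →ₗ[ℝ] Lp ℝ (ENNReal.ofReal q) (volume : Measure (Rn N)) :=
    { toFun := fun φ => (IsTest.memLp φ.2 _).toLp φ.1
      map_add' := fun φ ψ => rfl
      map_smul' := fun c φ => rfl }
  -- Test functions are dense in `L^q` as `q < ∞`, so the functional extends with the same bound.
  have he : DenseRange e := by
    refine (Lp.dense_hasCompactSupport_contDiff (F := ℝ) (p := ENNReal.ofReal q)
      (μ := (volume : Measure (Rn N))) ENNReal.ofReal_ne_top).mono ?_
    rintro a ⟨g, hag, hgc, hgd⟩
    refine ⟨⟨g, hgd, hgc⟩, ?_⟩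
    refine Lp.ext ?_
    exact (MemLp.coeFn_toLp (IsTest.memLp ⟨hgd, hgc⟩ _)).trans hag.symm
  have hfe : ∀ φ, ‖f φ‖ ≤ C.toReal * ‖e φ‖ := by
    intro φ
    have h1 := hbd φ.1 φ.2
    have h2 : ‖e φ‖ = (eLpNorm φ.1 (ENNReal.ofReal q) volume).toReal :=
      Lp.norm_toLp _ (IsTest.memLp φ.2 _)
    rw [h2, ← ENNReal.toReal_mul, ← toReal_enorm]
    exact ENNReal.toReal_mono (ENNReal.mul_ne_top hC (IsTest.memLp φ.2 _).eLpNorm_ne_top) h1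
  let S : (Rn N → ℝ) → ℝ := fun a =>
    if h : MemLp a (ENNReal.ofReal q) volume then f.extendOfNorm e (h.toLp a) else 0
  have hS : IsLqFunctional volume q S C := by
    refine ⟨fun a b ha hb => ?_, fun c a ha => ?_, fun a ha => ?_⟩
    · simp only [S, dif_pos ha, dif_pos hb, dif_pos (ha.add hb)]
      exact map_add (f.extendOfNorm e) (ha.toLp a) (hb.toLp b)
    · simp only [S, dif_pos ha, dif_pos (ha.const_smul c)]
      exact map_smul (f.extendOfNorm e) c (ha.toLp a)
    · simp only [S, dif_pos ha]
      have h1 := LinearMap.norm_extendOfNorm_apply_le he _ hfe (ha.toLp a)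
      rw [Lp.norm_toLp, ← ENNReal.toReal_mul, ← toReal_enorm] at h1
      exact (ENNReal.toReal_le_toReal enorm_ne_top
        (ENNReal.mul_ne_top hC ha.eLpNorm_ne_top)).1 h1
  obtain ⟨g, hgm, hgp, hg⟩ := hS.exists_representation hpq hC
  refine ⟨g, ⟨hgm.aestronglyMeasurable, ?_⟩, hgp, fun φ hφ => ?_⟩
  · rw [eLpNorm_eq_lintegral_rpow hp]
    exact ENNReal.rpow_lt_top_of_nonneg (by positivity)
      (ne_top_of_le_ne_top (ENNReal.rpow_ne_top_of_nonneg hp.le hC) hgp)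
  · rw [← hg φ hφ.continuous.measurable (hφ.memLp _)]
    simp only [S, dif_pos (hφ.memLp (ENNReal.ofReal q))]
    exact (LinearMap.extendOfNorm_eq he ⟨_, hfe⟩ ⟨φ, hφ⟩).symm

/-- The `L^1` norm of a vector field is the supremum of its pairings with test fields bounded
by `1`. -/
theorem lintegral_enorm_le_of_test {N : ℕ} {H : Type*} [NormedAddCommGroup H]
    [InnerProductSpace ℝ H] {F : Rn N → H} (hF : Integrable F) {C : ℝ≥0∞}
    (h : ∀ Φ : Rn N → H, IsTest Φ → (∀ x, ‖Φ x‖ ≤ 1) →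
      ENNReal.ofReal (∫ x, inner ℝ (F x) (Φ x)) ≤ C) : ∫⁻ x, ‖F x‖ₑ ≤ C := by
  rcases eq_or_ne C ⊤ with rfl | hC
  · exact le_top
  have hreal : ∀ Φ : Rn N → H, IsTest Φ → (∀ x, ‖Φ x‖ ≤ 1) →
      ∫ x, inner ℝ (F x) (Φ x) ≤ C.toReal := fun Φ hΦ h1 =>
    (ENNReal.ofReal_le_iff_le_toReal hC).1 (h Φ hΦ h1)
  rw [← ofReal_integral_norm_eq_lintegral_enorm hF, ENNReal.ofReal_le_iff_le_toReal hC]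
  refine le_of_forall_pos_le_add fun ε hε => ?_
  obtain ⟨g, hgc, hgd, hg⟩ := (memLp_one_iff_integrable.2 hF).exist_eLpNorm_sub_le
    ENNReal.one_ne_top le_rfl (ε := ε / 3) (by positivity)
  have hgt : IsTest g := ⟨hgd, hgc⟩
  have hFg : Integrable (F - g) := hF.sub hgt.integrable
  have hgε : ∫ x, ‖(F - g) x‖ ≤ ε / 3 := by
    rw [integral_norm_eq_lintegral_enorm hFg.1, ← eLpNorm_one_eq_lintegral_enorm]
    exact ENNReal.toReal_le_of_le_ofReal (by positivity) hg
  set V := (volume : Measure (Rn N)).real (tsupport g) with hV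
  have hV0 : 0 ≤ V := measureReal_nonneg
  -- The error `δ` is paid on the support of `g`, of volume `V`; `V + 1` avoids dividing by zero.
  -- The other two thirds of `ε` pay for replacing `F` by `g` twice.
  set δ := ε / 3 / (V + 1) with hδ
  have hδ0 : 0 < δ := by positivity
  have hδV : δ * V ≤ ε / 3 := by
    rw [hδ, div_mul_eq_mul_div, div_le_iff₀ (by positivity)]
    nlinarith
  -- The ideal test field `g / |g|` is not smooth where `g` vanishes; `√(|g|² + δ²)` regularises the
  -- denominator and keeps the field bounded by `1`.
  set r : Rn N → ℝ := fun x => Real.sqrt (‖g x‖ ^ 2 + δ ^ 2) with hr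
  have hr0 : ∀ x, 0 < r x := fun x => Real.sqrt_pos.2 (by positivity)
  have hrg : ∀ x, ‖g x‖ ≤ r x := fun x => Real.le_sqrt_of_sq_le (by nlinarith)
  have hrg' : ∀ x, r x ≤ ‖g x‖ + δ := fun x =>
    Real.sqrt_le_iff.2 ⟨by positivity, by nlinarith [norm_nonneg (g x)]⟩
  set Φ : Rn N → H := fun x => (r x)⁻¹ • g x with hΦ
  have hrd : ContDiff ℝ ∞ r :=
    ContDiff.sqrt ((hgd.norm_sq ℝ).add contDiff_const) fun x => by positivity
  have hΦt : IsTest Φ :=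
    ⟨(hrd.inv fun x => (hr0 x).ne').smul hgd, hgc.smul_left (f := fun x => (r x)⁻¹)⟩
  have hΦ1 : ∀ x, ‖Φ x‖ ≤ 1 := fun x => by
    rw [hΦ, norm_smul, norm_inv, Real.norm_of_nonneg (hr0 x).le, inv_mul_le_iff₀ (hr0 x), mul_one]
    exact hrg x
  have hint : Integrable fun x => inner ℝ (F x) (Φ x) := by
    refine hF.norm.mono' (hF.1.inner hΦt.continuous.aestronglyMeasurable)
      (Eventually.of_forall fun x => ?_)
    refine (norm_inner_le_norm _ _).trans ?_
    exact mul_le_of_le_one_right (norm_nonneg _) (hΦ1 x)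
  have hind : Integrable ((tsupport g).indicator fun _ => δ) := by
    refine (integrable_indicator_iff (isClosed_tsupport g).measurableSet).2 ?_
    exact integrableOn_const hgc.measure_lt_top.ne
  have hpt : ∀ x, ‖F x‖ ≤ 2 * ‖(F - g) x‖ + inner ℝ (F x) (Φ x) +
      (tsupport g).indicator (fun _ => δ) x := by
    intro x
    have h1 : ‖F x‖ ≤ ‖(F - g) x‖ + ‖g x‖ := by
      have := norm_add_le ((F - g) x) (g x)
      simpa using this
    have h2 : inner ℝ (g x) (Φ x) ≤ inner ℝ (F x) (Φ x) + ‖(F - g) x‖ := by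
      have e : inner ℝ (g x) (Φ x) = inner ℝ (F x) (Φ x) - inner ℝ ((F - g) x) (Φ x) := by
        rw [Pi.sub_apply, inner_sub_left]
        ring
      have h3 := abs_real_inner_le_norm ((F - g) x) (Φ x)
      have h4 : ‖(F - g) x‖ * ‖Φ x‖ ≤ ‖(F - g) x‖ :=
        mul_le_of_le_one_right (norm_nonneg _) (hΦ1 x)
      have h5 := neg_abs_le (inner ℝ ((F - g) x) (Φ x))
      linarith
    have h6 : ‖g x‖ ≤ inner ℝ (g x) (Φ x) + (tsupport g).indicator (fun _ => δ) x := by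
      rw [hΦ, real_inner_smul_right, real_inner_self_eq_norm_sq]
      by_cases hx : x ∈ tsupport g
      · rw [indicator_of_mem hx]
        -- If `|g| ≤ δ` the left side is nonpositive; otherwise `(|g| - δ) r ≤ (|g| - δ)(|g| + δ) ≤
        -- |g|²`.
        have h7 : ‖g x‖ - δ ≤ (r x)⁻¹ * ‖g x‖ ^ 2 := by
          rw [inv_mul_eq_div, le_div_iff₀ (hr0 x)]
          rcases le_total ‖g x‖ δ with hle | hle
          · nlinarith [hr0 x, sq_nonneg ‖g x‖]
          · nlinarith [hrg' x]
        linarith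
      · rw [image_eq_zero_of_notMem_tsupport hx]
        simp [hx]
    linarith
  have hsum : Integrable fun x => 2 * ‖(F - g) x‖ + inner ℝ (F x) (Φ x) :=
    (hFg.norm.const_mul 2).add hint
  have hfin := integral_mono hF.norm (hsum.add hind) hpt
  have e1 : ∫ x, (2 * ‖(F - g) x‖ + inner ℝ (F x) (Φ x) +
      (tsupport g).indicator (fun _ => δ) x) = 2 * (∫ x, ‖(F - g) x‖) +
      (∫ x, inner ℝ (F x) (Φ x)) + δ * V := by
    rw [integral_add hsum hind,
      integral_add (hFg.norm.const_mul 2) hint, integral_const_mul,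
      integral_indicator (isClosed_tsupport g).measurableSet, setIntegral_const, smul_eq_mul,
      mul_comm V δ]
  have hc := hreal Φ hΦt hΦ1
  simp only [Pi.add_apply] at hfin
  rw [e1] at hfin
  linarith

/-! ### Averages along segments -/

/-- The average of `φ` over the segment from `x` to `x - v`. -/
noncomputable def segmentAverage {N : ℕ} {F : Type*} [NormedAddCommGroup F] [NormedSpace ℝ F]
    (v : Rn N) (φ : Rn N → F) (x : Rn N) : F :=
  ∫ s in (0 : ℝ)..1, φ (x - s • v)

theorem hasFDerivAt_segmentAverage {N : ℕ} {F : Type*} [NormedAddCommGroup F] [NormedSpace ℝ F]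
    (v : Rn N) {φ : Rn N → F} (hφ : ContDiff ℝ 1 φ) (hc : HasCompactSupport φ) (x : Rn N) :
    HasFDerivAt (segmentAverage v φ) (segmentAverage v (fderiv ℝ φ) x) x := by
  have hφ' : Continuous (fderiv ℝ φ) := hφ.continuous_fderiv (by simp)
  obtain ⟨C, hC⟩ := (hc.fderiv ℝ).exists_bound_of_continuous hφ'
  have hcont : ∀ y : Rn N, Continuous fun s : ℝ => φ (y - s • v) := fun y =>
    hφ.continuous.comp (by fun_prop)
  refine intervalIntegral.hasFDerivAt_integral_of_dominated_of_fderiv_le (s := univ)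
    (F := fun y s => φ (y - s • v)) (F' := fun y s => fderiv ℝ φ (y - s • v))
    (bound := fun _ => C) univ_mem ?_ ?_ ?_ ?_ ?_ ?_
  · exact Eventually.of_forall fun y => (hcont y).aestronglyMeasurable
  · exact (hcont x).intervalIntegrable _ _
  · exact (hφ'.comp (by fun_prop : Continuous fun s : ℝ => x - s • v)).aestronglyMeasurable
  · exact Eventually.of_forall fun s _ y _ => hC _
  · exact intervalIntegrable_const
  · refine Eventually.of_forall fun s _ y _ => ?_
    have h1 := (hφ.differentiable (by simp) (y - s • v)).hasFDerivAt
    have h2 : HasFDerivAt (fun y : Rn N => y - s • v) (ContinuousLinearMap.id ℝ (Rn N)) y :=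
      (hasFDerivAt_id y).sub_const _
    have h3 := h1.comp y h2
    rw [ContinuousLinearMap.comp_id] at h3
    exact h3

/-- The derivative of a segment average is the segment average of the derivative, so smoothness
follows by induction. The target space is quantified inside because differentiation changes it. -/
theorem contDiff_segmentAverage {N : ℕ} (v : Rn N) (n : ℕ) :
    ∀ {F : Type} [NormedAddCommGroup F] [NormedSpace ℝ F] {φ : Rn N → F},
      ContDiff ℝ ∞ φ → HasCompactSupport φ → ContDiff ℝ n (segmentAverage v φ) := by
  induction n with
  | zero =>
    intro F _ _ φ hφ hc
    exact contDiff_zero.2 (continuous_iff_continuousAt.2 fun x =>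
      (hasFDerivAt_segmentAverage v (hφ.of_le (by simp)) hc x).continuousAt)
  | succ n ih =>
    intro F _ _ φ hφ hc
    push_cast
    exact contDiff_succ_iff_hasFDerivAt.2 ⟨_, ih (hφ.fderiv_right (m := ∞) (by simp)) (hc.fderiv ℝ),
      hasFDerivAt_segmentAverage v (hφ.of_le (by simp)) hc⟩

theorem IsTest.segmentAverage {N : ℕ} {φ : Rn N → ℝ} (h : IsTest φ) (v : Rn N) :
    IsTest (segmentAverage v φ) := by
  refine ⟨contDiff_infty.2 fun n => contDiff_segmentAverage v n h.1 h.2, ?_⟩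
  -- The support lies in the compact set swept out by translating the support of `φ` along the
  -- segment.
  have hK : IsCompact ((fun z : ℝ × Rn N => z.2 + z.1 • v) '' (Icc 0 1 ×ˢ tsupport φ)) :=
    (isCompact_Icc.prod h.2).image (by fun_prop)
  refine HasCompactSupport.intro hK fun x hx => ?_
  refine (intervalIntegral.integral_congr (g := fun _ => 0) fun s hs => ?_).trans (by simp)
  rw [uIcc_of_le zero_le_one] at hs
  by_contra hne
  exact hx ⟨(s, x - s • v), ⟨hs, subset_tsupport _ hne⟩, by simp⟩

/-- Fundamental theorem of calculus on the segment. A finite difference of a test function thus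
becomes an exact derivative of another test function, to which weak derivatives and variations
apply. -/
theorem IsTest.fderiv_segmentAverage {N : ℕ} {φ : Rn N → ℝ} (h : IsTest φ) (v x : Rn N) :
    fderiv ℝ (NonlocalBBM.segmentAverage v φ) x v = φ x - φ (x - v) := by
  have hφ' : Continuous (fderiv ℝ φ) := h.1.continuous_fderiv (by simp)
  have hc : Continuous fun s : ℝ => fderiv ℝ φ (x - s • v) :=
    hφ'.comp (by fun_prop : Continuous fun s : ℝ => x - s • v)
  rw [(hasFDerivAt_segmentAverage v (h.1.of_le (by simp)) h.2 x).fderiv,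
    NonlocalBBM.segmentAverage, ContinuousLinearMap.intervalIntegral_apply
      (hc.intervalIntegrable _ _)]
  have hd : ∀ s ∈ uIcc (0 : ℝ) 1, HasDerivAt (fun s : ℝ => -φ (x - s • v))
      (fderiv ℝ φ (x - s • v) v) s := by
    intro s _
    have h1 := (h.differentiable (x - s • v)).hasFDerivAt
    have h2 : HasDerivAt (fun s : ℝ => x - s • v) (-v) s := by
      simpa using ((hasDerivAt_id s).smul_const v).const_sub x
    have h3 := (h1.comp_hasDerivAt s h2).neg
    rw [map_neg, neg_neg] at h3
    exact h3
  rw [intervalIntegral.integral_eq_sub_of_hasDerivAt hd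
    ((hc.clm_apply continuous_const).intervalIntegrable _ _)]
  simp
  ring

theorem abs_segmentAverage_le {N : ℕ} {φ : Rn N → ℝ} {C : ℝ} (h : ∀ x, |φ x| ≤ C) (v x : Rn N) :
    |segmentAverage v φ x| ≤ C := by
  have := intervalIntegral.norm_integral_le_of_norm_le_const (a := (0 : ℝ)) (b := 1)
    (f := fun s : ℝ => φ (x - s • v)) (C := C) fun s _ => h _
  simpa [segmentAverage] using this

/-- Jensen's inequality on the unit interval, then Tonelli and translation invariance. -/
theorem eLpNorm_segmentAverage_le {N : ℕ} {φ : Rn N → ℝ} (hφ : Continuous φ) {q : ℝ} (hq : 1 ≤ q)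
    (v : Rn N) : eLpNorm (segmentAverage v φ) (ENNReal.ofReal q) volume ≤
      eLpNorm φ (ENNReal.ofReal q) volume := by
  have hq0 : 0 < q := by linarith
  rw [eLpNorm_eq_lintegral_rpow hq0, eLpNorm_eq_lintegral_rpow hq0]
  refine ENNReal.rpow_le_rpow ?_ (by positivity)
  have : IsProbabilityMeasure (volume.restrict (Ioc (0 : ℝ) 1)) := ⟨by simp⟩
  have hpt : ∀ x, ‖segmentAverage v φ x‖ₑ ^ q ≤
      ∫⁻ s in Ioc (0 : ℝ) 1, ‖φ (x - s • v)‖ₑ ^ q := by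
    intro x
    have hc : Continuous fun s : ℝ => φ (x - s • v) := hφ.comp (by fun_prop)
    rw [← eLpNorm_rpow_eq_lintegral hq0]
    refine ENNReal.rpow_le_rpow ?_ hq0.le
    rw [segmentAverage, intervalIntegral.integral_of_le zero_le_one]
    refine (enorm_integral_le_lintegral_enorm _).trans ?_
    rw [← eLpNorm_one_eq_lintegral_enorm]
    exact eLpNorm_le_eLpNorm_of_exponent_le (by simpa using hq) hc.aestronglyMeasurable
  refine (lintegral_mono hpt).trans ?_
  rw [lintegral_lintegral_swap]
  · have : ∀ s : ℝ, ∫⁻ x, ‖φ (x - s • v)‖ₑ ^ q = ∫⁻ x, ‖φ x‖ₑ ^ q := fun s =>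
      lintegral_sub_right_eq_self (fun x => ‖φ x‖ₑ ^ q) (s • v)
    simp_rw [this]
    simp
  · have : Continuous fun z : Rn N × ℝ => φ (z.1 - z.2 • v) := hφ.comp (by fun_prop)
    exact (this.measurable.enorm.pow_const q).aemeasurable

/-! ### Pairings with test functions -/

theorem enorm_integral_mul_le {α : Type*} [MeasurableSpace α] {μ : Measure α} {p q : ℝ}
    (hpq : p.HolderConjugate q) {f g : α → ℝ} (hf : AEStronglyMeasurable f μ)
    (hg : AEStronglyMeasurable g μ) :
    ‖∫ x, f x * g x ∂μ‖ₑ ≤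
      eLpNorm f (ENNReal.ofReal p) μ * eLpNorm g (ENNReal.ofReal q) μ := by
  refine (enorm_integral_le_lintegral_enorm _).trans ?_
  simp_rw [enorm_mul]
  rw [eLpNorm_eq_lintegral_rpow hpq.pos, eLpNorm_eq_lintegral_rpow hpq.symm.pos]
  exact ENNReal.lintegral_mul_le_Lp_mul_Lq μ hpq hf.enorm hg.enorm

theorem integral_sub_comp_mul {N : ℕ} {u φ : Rn N → ℝ} (hu : LocallyIntegrable u) (hφ : IsTest φ)
    (v : Rn N) : ∫ x, (u (x + v) - u x) * φ x = ∫ x, u x * (φ (x - v) - φ x) := by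
  have h1 : Integrable fun x => u x * φ x := hφ.integrable_mul hu
  have hφv : IsTest fun x => φ (x - v) :=
    ⟨hφ.1.comp (contDiff_id.sub contDiff_const),
      hφ.2.comp_homeomorph (Homeomorph.subRight v)⟩
  have h2 : Integrable fun x => u x * φ (x - v) := hφv.integrable_mul hu
  have h3 : Integrable fun x => u (x + v) * φ x := by
    simpa using h2.comp_add_right v
  have h4 : ∫ x, u (x + v) * φ x = ∫ x, u x * φ (x - v) := by
    rw [← integral_add_right_eq_self (fun x => u x * φ (x - v)) v]
    simp
  simp_rw [sub_mul, mul_sub]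
  rw [integral_sub h3 h1, integral_sub h2 h1, h4]

/-- Split `u_k ξ_k = (u_k - u₀) ξ_k + u₀ ξ_k`: Hölder on the finite-measure set `B` kills the first
term, dominated convergence handles the second. This covers `p = 1` as well. -/
theorem tendsto_integral_mul_of_tendstoLp {N : ℕ} {p : ℝ} (hp : 1 ≤ p) {u : ℕ → Rn N → ℝ}
    {u₀ : Rn N → ℝ} (hu : ∀ k, MemLp (u k) (expo p)) (hu₀ : MemLp u₀ (expo p))
    (h : TendstoLp p u u₀) {ξ : ℕ → Rn N → ℝ} {ξ₀ : Rn N → ℝ} (hξ : ∀ k, Continuous (ξ k))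
    {C : ℝ} {B : Set (Rn N)} (hB : MeasurableSet B) (hBfin : volume B ≠ ⊤)
    (hbd : ∀ᶠ k in atTop, ∀ x, |ξ k x| ≤ B.indicator (fun _ => C) x)
    (hlim : ∀ x, Tendsto (fun k => ξ k x) atTop (𝓝 (ξ₀ x))) :
    Tendsto (fun k => ∫ x, u k x * ξ k x) atTop (𝓝 (∫ x, u₀ x * ξ₀ x)) := by
  have hp1 : (1 : ℝ≥0∞) ≤ expo p := by simpa [expo] using hp
  have : IsFiniteMeasure (volume.restrict B) := ⟨by simpa using hBfin.lt_top⟩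
  have hloc : ∀ w : Rn N → ℝ, MemLp w (expo p) → Integrable (B.indicator fun x => ‖w x‖ * C) := by
    intro w hw
    refine (integrable_indicator_iff hB).2 ?_
    exact (((hw.restrict B).integrable hp1).norm).mul_const C
  have hle : ∀ w : Rn N → ℝ, ∀ k, (∀ x, |ξ k x| ≤ B.indicator (fun _ => C) x) → ∀ x,
      ‖w x * ξ k x‖ ≤ B.indicator (fun x => ‖w x‖ * C) x := by
    intro w k hk x
    rw [norm_mul]
    by_cases hx : x ∈ B
    · have := hk x
      rw [indicator_of_mem hx] at this ⊢
      exact mul_le_mul_of_nonneg_left this (norm_nonneg _)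
    · have := hk x
      rw [indicator_of_notMem hx] at this ⊢
      rw [Real.norm_eq_abs (ξ k x), le_antisymm this (abs_nonneg _), mul_zero]
  have hint : ∀ w : Rn N → ℝ, MemLp w (expo p) → ∀ k, (∀ x, |ξ k x| ≤ B.indicator (fun _ => C) x) →
      Integrable fun x => w x * ξ k x := fun w hw k hk =>
    (hloc w hw).mono' (hw.1.mul (hξ k).aestronglyMeasurable) (Eventually.of_forall (hle w k hk))
  have h1 : Tendsto (fun k => ∫ x, u₀ x * ξ k x) atTop (𝓝 (∫ x, u₀ x * ξ₀ x)) := by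
    refine tendsto_integral_filter_of_dominated_convergence
      (B.indicator fun x => ‖u₀ x‖ * C) ?_ ?_ (hloc u₀ hu₀) ?_
    · exact Eventually.of_forall fun k => hu₀.1.mul (hξ k).aestronglyMeasurable
    · filter_upwards [hbd] with k hk
      exact Eventually.of_forall (hle u₀ k hk)
    · exact Eventually.of_forall fun x => (hlim x).const_mul _
  have h2 : Tendsto (fun k => ∫ x, (u k - u₀) x * ξ k x) atTop (𝓝 0) := by
    rw [tendsto_zero_iff_enorm_tendsto_zero]
    have h3 : Tendsto (fun k => eLpNorm (fun x => u k x - u₀ x) (expo p) volume *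
        volume B ^ (1 / (1 : ℝ≥0∞).toReal - 1 / (expo p).toReal) * ‖C‖ₑ) atTop (𝓝 (0 *
        volume B ^ (1 / (1 : ℝ≥0∞).toReal - 1 / (expo p).toReal) * ‖C‖ₑ)) := by
      have hne : volume B ^ (1 / (1 : ℝ≥0∞).toReal - 1 / (expo p).toReal) ≠ ⊤ := by
        refine ENNReal.rpow_ne_top_of_nonneg ?_ hBfin
        rw [expo, ENNReal.toReal_ofReal (by linarith)]
        simp only [ENNReal.toReal_one, div_one, one_div, sub_nonneg]
        exact inv_le_one_of_one_le₀ hp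
      exact ENNReal.Tendsto.mul_const (ENNReal.Tendsto.mul_const h (Or.inr hne))
        (Or.inr enorm_ne_top)
    rw [zero_mul, zero_mul] at h3
    refine tendsto_of_tendsto_of_tendsto_of_le_of_le' tendsto_const_nhds h3
      (Eventually.of_forall fun _ => zero_le) ?_
    filter_upwards [hbd] with k hk
    have hw : MemLp (u k - u₀) (expo p) := (hu k).sub hu₀
    refine (enorm_integral_le_lintegral_enorm _).trans ?_
    calc ∫⁻ x, ‖(u k - u₀) x * ξ k x‖ₑ ≤ ∫⁻ x in B, ‖(u k - u₀) x‖ₑ * ‖C‖ₑ := by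
          rw [← lintegral_indicator hB]
          refine lintegral_mono fun x => ?_
          have := hk x
          by_cases hx : x ∈ B
          · rw [indicator_of_mem hx] at this ⊢
            rw [enorm_mul]
            gcongr
            rw [enorm_le_iff_norm_le]
            exact this.trans (le_abs_self _)
          · rw [indicator_of_notMem hx] at this ⊢
            have h0 : ξ k x = 0 := abs_eq_zero.1 (le_antisymm this (abs_nonneg _))
            simp [h0]
      _ = eLpNorm (u k - u₀) 1 (volume.restrict B) * ‖C‖ₑ := by
          rw [lintegral_mul_const' _ _ enorm_ne_top, eLpNorm_one_eq_lintegral_enorm]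
      _ ≤ _ := by
          gcongr
          refine (eLpNorm_le_eLpNorm_mul_rpow_measure_univ hp1 (hw.1.restrict)).trans ?_
          rw [Measure.restrict_apply_univ]
          gcongr
          exact eLpNorm_mono_measure _ Measure.restrict_le_self
  have h4 := h2.add h1
  rw [zero_add] at h4
  refine h4.congr' ?_
  filter_upwards [hbd] with k hk
  rw [← integral_add (hint _ ((hu k).sub hu₀) k hk) (hint _ hu₀ k hk)]
  congr 1 with x
  simp only [Pi.sub_apply]
  ring

variable {N : ℕ}

/-! ### Difference quotients -/

/-- `‖b (u(· + w / b) - u)‖_p^p`. -/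
noncomputable def diffQuotient (p b : ℝ) (u : Rn N → ℝ) (w : Rn N) : ℝ≥0∞ :=
  ENNReal.ofReal (b ^ p) * ∫⁻ x, ‖u (x + b⁻¹ • w) - u x‖ₑ ^ p

theorem memLp_comp_add {p : ℝ≥0∞} {u : Rn N → ℝ} (hu : MemLp u p) (v : Rn N) :
    MemLp (fun x => u (x + v)) p :=
  hu.comp_measurePreserving (measurePreserving_add_right volume v)

theorem locallyIntegrable_of_memLp {p : ℝ} (hp : 1 ≤ p) {u : Rn N → ℝ} (hu : MemLp u (expo p)) :
    LocallyIntegrable u :=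
  hu.locallyIntegrable (by simpa [expo] using hp)

theorem integral_sub_comp_mul_eq_segmentAverage {u φ : Rn N → ℝ} (hu : LocallyIntegrable u)
    (hφ : IsTest φ) {b : ℝ} (w : Rn N) :
    ∫ x, (u (x + b⁻¹ • w) - u x) * φ x =
      -(b⁻¹ * ∫ x, u x * fderiv ℝ (segmentAverage (b⁻¹ • w) φ) x w) := by
  rw [integral_sub_comp_mul hu hφ, ← integral_const_mul, ← integral_neg]
  congr 1 with x
  have h := hφ.fderiv_segmentAverage (b⁻¹ • w) x
  rw [map_smul, smul_eq_mul] at h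
  linear_combination u x * h

/-- By `L^1` duality: a test function `φ` bounded by `1` is traded for minus its segment average,
which is again bounded by `1` and so admissible in the variation. -/
theorem diffQuotient_one_le_dirVariation {u : Rn N → ℝ} (hu : MemLp u 1) {b : ℝ} (hb : 0 < b)
    (w : Rn N) : diffQuotient 1 b u w ≤ dirVariation u w := by
  have hint : Integrable fun x => u (x + b⁻¹ • w) - u x :=
    memLp_one_iff_integrable.1 ((memLp_comp_add hu _).sub hu)
  have hloc : LocallyIntegrable u := hu.locallyIntegrable le_rfl
  have key : ∫⁻ x, ‖u (x + b⁻¹ • w) - u x‖ₑ ≤ ENNReal.ofReal b⁻¹ * dirVariation u w := by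
    refine lintegral_enorm_le_of_test hint fun φ hφ hφ1 => ?_
    have h1 : ∫ x, inner ℝ (u (x + b⁻¹ • w) - u x) (φ x) =
        b⁻¹ * ∫ x, u x * fderiv ℝ (-segmentAverage (b⁻¹ • w) φ) x w := by
      have e : ∀ x, inner ℝ (u (x + b⁻¹ • w) - u x) (φ x) = (u (x + b⁻¹ • w) - u x) * φ x :=
        fun x => by simp [mul_comm]
      simp_rw [e]
      rw [integral_sub_comp_mul_eq_segmentAverage hloc hφ, ← mul_neg, ← integral_neg]
      congr 2 with x
      rw [fderiv_neg]
      simp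
    rw [h1, ENNReal.ofReal_mul (by positivity)]
    gcongr
    exact le_iSup (fun φ : {φ : Rn N → ℝ // IsTest φ ∧ ∀ x, |φ x| ≤ 1} =>
      ENNReal.ofReal (∫ x, u x * fderiv ℝ φ.1 x w))
      ⟨-segmentAverage (b⁻¹ • w) φ, (hφ.segmentAverage _).neg, fun x => by
        rw [Pi.neg_apply, abs_neg]
        exact abs_segmentAverage_le hφ1 _ x⟩
  unfold diffQuotient
  simp only [ENNReal.rpow_one, Real.rpow_one]
  calc _ ≤ ENNReal.ofReal b * (ENNReal.ofReal b⁻¹ * dirVariation u w) := by gcongr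
    _ = dirVariation u w := by
      rw [← mul_assoc, ← ENNReal.ofReal_mul hb.le, mul_inv_cancel₀ hb.ne', ENNReal.ofReal_one,
        one_mul]

theorem ae_eq_of_test {f g : Rn N → ℝ} (hf : LocallyIntegrable f) (hg : LocallyIntegrable g)
    (h : ∀ φ, IsTest φ → ∫ x, f x * φ x = ∫ x, g x * φ x) : f =ᵐ[volume] g :=
  ae_eq_of_integral_contDiff_smul_eq hf hg fun φ h1 h2 => by
    simpa only [smul_eq_mul, mul_comm] using h φ ⟨h1, h2⟩

/-- The weak derivative bounds the pairing of the increment with `φ` by `b⁻¹ ‖g‖_p ‖φ‖_q`.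
Representing this functional recovers the increment almost everywhere, with the sharp norm bound. -/
theorem diffQuotient_le_lintegral {p : ℝ} (hp : 1 < p) {u : Rn N → ℝ} (hu : MemLp u (expo p))
    {b : ℝ} (hb : 0 < b) {w : Rn N} {g : Rn N → ℝ} (hg : MemLp g (expo p))
    (hug : HasWeakDirDeriv u w g) : diffQuotient p b u w ≤ ∫⁻ x, ‖g x‖ₑ ^ p := by
  have hp0 : 0 < p := by linarith
  have hpq := Real.HolderConjugate.conjExponent hp
  set q := p.conjExponent
  have hloc := locallyIntegrable_of_memLp hp.le hu
  have hf : MemLp (fun x => u (x + b⁻¹ • w) - u x) (expo p) := (memLp_comp_add hu _).sub hu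
  have hfloc := locallyIntegrable_of_memLp hp.le hf
  set C : ℝ≥0∞ := ENNReal.ofReal b⁻¹ * eLpNorm g (expo p) volume
  have hC : C ≠ ⊤ := ENNReal.mul_ne_top ENNReal.ofReal_ne_top hg.eLpNorm_ne_top
  have hrep : ∃ g' : Rn N → ℝ, MemLp g' (expo p) ∧ ∫⁻ x, ‖g' x‖ₑ ^ p ≤ C ^ p ∧
      ∀ φ, IsTest φ → ∫ x, (u (x + b⁻¹ • w) - u x) * φ x = ∫ x, g' x * φ x := by
    refine exists_representation_of_test_bound (N := N) hpq
      (T := fun φ => ∫ x, (u (x + b⁻¹ • w) - u x) * φ x) hC ?_ ?_ ?_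
    · intro φ ψ hφ hψ
      rw [← integral_add (hφ.integrable_mul hfloc) (hψ.integrable_mul hfloc)]
      congr 1 with x
      simp only [Pi.add_apply]
      ring
    · intro c φ hφ
      rw [← integral_const_mul]
      congr 1 with x
      simp only [Pi.smul_apply, smul_eq_mul]
      ring
    · intro φ hφ
      have hψ := hφ.segmentAverage (b⁻¹ • w)
      rw [integral_sub_comp_mul_eq_segmentAverage hloc hφ, hug _ hψ, mul_neg, neg_neg, enorm_mul,
        Real.enorm_eq_ofReal (by positivity), mul_assoc]
      gcongr
      refine (enorm_integral_mul_le hpq hg.1 hψ.continuous.aestronglyMeasurable).trans ?_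
      exact mul_le_mul_right (eLpNorm_segmentAverage_le hφ.continuous hpq.symm.lt.le _) _
  obtain ⟨g', hg'L, hg'p, hg'⟩ := hrep
  have hae : (fun x => u (x + b⁻¹ • w) - u x) =ᵐ[volume] g' :=
    ae_eq_of_test hfloc (locallyIntegrable_of_memLp hp.le hg'L) hg'
  unfold diffQuotient
  calc ENNReal.ofReal (b ^ p) * ∫⁻ x, ‖u (x + b⁻¹ • w) - u x‖ₑ ^ p
      = ENNReal.ofReal (b ^ p) * ∫⁻ x, ‖g' x‖ₑ ^ p := by
        congr 1
        refine lintegral_congr_ae ?_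
        filter_upwards [hae] with x hx
        rw [hx]
    _ ≤ ENNReal.ofReal (b ^ p) * C ^ p := by gcongr
    _ = ∫⁻ x, ‖g x‖ₑ ^ p := by
        rw [ENNReal.mul_rpow_of_nonneg _ _ hp0.le, eLpNorm_rpow_eq_lintegral hp0,
          ENNReal.ofReal_rpow_of_nonneg (by positivity) hp0.le, ← mul_assoc,
          ← ENNReal.ofReal_mul (by positivity), ← Real.mul_rpow hb.le (by positivity),
          mul_inv_cancel₀ hb.ne', Real.one_rpow, ENNReal.ofReal_one, one_mul]

/-- Difference quotients are bounded by the directional energy. -/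
theorem diffQuotient_le_dirEnergy {p : ℝ} (hp : 1 ≤ p) {u : Rn N → ℝ} (hu : MemLp u (expo p))
    {b : ℝ} (hb : 0 < b) (w : Rn N) : diffQuotient p b u w ≤ dirEnergy p u w := by
  unfold dirEnergy
  split_ifs with h1
  · subst h1
    exact diffQuotient_one_le_dirVariation (by simpa [expo] using hu) hb w
  · exact le_iInf fun g => diffQuotient_le_lintegral (lt_of_le_of_ne hp (Ne.symm h1)) hu hb
      g.2.1 g.2.2

/-- Discrete integration by parts in the limit of vanishing step. -/
theorem tendsto_integral_diffQuotient_mul {p : ℝ} (hp : 1 ≤ p) {u : ℕ → Rn N → ℝ} {u₀ : Rn N → ℝ}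
    (hu : ∀ k, MemLp (u k) (expo p)) (hu₀ : MemLp u₀ (expo p)) (h : TendstoLp p u u₀) {b : ℕ → ℝ}
    (hb : Tendsto b atTop atTop) (w : Rn N) {φ : Rn N → ℝ} (hφ : IsTest φ) :
    Tendsto (fun k => ∫ x, (b k * (u k (x + (b k)⁻¹ • w) - u k x)) * φ x) atTop
      (𝓝 (-∫ x, u₀ x * fderiv ℝ φ x w)) := by
  obtain ⟨L, hL⟩ := hφ.1.lipschitzWith_of_hasCompactSupport hφ.2 (by simp)
  obtain ⟨R, hR⟩ := hφ.2.isBounded.subset_closedBall (0 : Rn N)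
  -- Once `b k ≥ 1` the shift is at most `‖w‖`, so all quotients of `φ` live in one ball, and the
  -- Lipschitz constant of `φ` bounds them.
  have key := tendsto_integral_mul_of_tendstoLp hp hu hu₀ h
    (ξ := fun k x => b k * (φ (x - (b k)⁻¹ • w) - φ x)) (ξ₀ := fun x => -fderiv ℝ φ x w)
    (C := L * ‖w‖) (B := Metric.closedBall 0 (R + ‖w‖)) ?_ measurableSet_closedBall
    measure_closedBall_lt_top.ne ?_ ?_
  · have e1 : ∀ k, ∫ x, (b k * (u k (x + (b k)⁻¹ • w) - u k x)) * φ x =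
        ∫ x, u k x * (b k * (φ (x - (b k)⁻¹ • w) - φ x)) := by
      intro k
      simp_rw [mul_assoc, mul_left_comm _ (b k)]
      rw [integral_const_mul, integral_const_mul,
        integral_sub_comp_mul (locallyIntegrable_of_memLp hp (hu k)) hφ]
    simp_rw [e1]
    simpa only [mul_neg, integral_neg] using key
  · intro k
    have := hφ.continuous
    fun_prop
  · filter_upwards [hb.eventually_ge_atTop 1] with k hk x
    have hk0 : 0 < b k := by linarith
    have hsmall : ‖(b k)⁻¹ • w‖ ≤ ‖w‖ := by
      rw [norm_smul, norm_inv, Real.norm_of_nonneg hk0.le]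
      exact mul_le_of_le_one_left (norm_nonneg _) (inv_le_one_of_one_le₀ hk)
    by_cases hx : x ∈ Metric.closedBall (0 : Rn N) (R + ‖w‖)
    · rw [indicator_of_mem hx, abs_mul, abs_of_pos hk0]
      have h1 := hL.dist_le_mul (x - (b k)⁻¹ • w) x
      rw [Real.dist_eq, dist_eq_norm, sub_sub_cancel_left, norm_neg, norm_smul, norm_inv,
        Real.norm_of_nonneg hk0.le] at h1
      calc b k * |φ (x - (b k)⁻¹ • w) - φ x| ≤ b k * (L * ((b k)⁻¹ * ‖w‖)) := by gcongr
        _ = L * ‖w‖ := by field_simp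
    · rw [indicator_of_notMem hx]
      rw [mem_closedBall_zero_iff, not_le] at hx
      have hR' : ∀ y : Rn N, R < ‖y‖ → φ y = 0 := by
        intro y hy
        refine image_eq_zero_of_notMem_tsupport fun hy' => ?_
        have := hR hy'
        rw [mem_closedBall_zero_iff] at this
        linarith
      have h1 : ‖x‖ - ‖(b k)⁻¹ • w‖ ≤ ‖x - (b k)⁻¹ • w‖ := norm_sub_norm_le _ _
      rw [hR' x (by linarith [norm_nonneg w]), hR' (x - (b k)⁻¹ • w) (by linarith)]
      simp
  · intro x
    have h1 := (hφ.differentiable x).hasFDerivAt.lim (-w) (c := b) (l := atTop)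
      (tendsto_norm_atTop_atTop.comp hb)
    simpa [sub_eq_add_neg] using h1

theorem eLpNorm_diffQuotient {p : ℝ} (hp : 1 ≤ p) {b : ℝ} (hb : 0 < b) (u : Rn N → ℝ) (w : Rn N) :
    eLpNorm (fun x => b * (u (x + b⁻¹ • w) - u x)) (expo p) volume =
      diffQuotient p b u w ^ (1 / p) := by
  have hp0 : 0 < p := by linarith
  rw [expo, eLpNorm_eq_lintegral_rpow hp0]
  congr 1
  unfold diffQuotient
  rw [← lintegral_const_mul' _ _ ENNReal.ofReal_ne_top]
  refine lintegral_congr fun x => ?_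
  rw [enorm_mul, ENNReal.mul_rpow_of_nonneg _ _ hp0.le, Real.enorm_eq_ofReal hb.le,
    ENNReal.ofReal_rpow_of_nonneg hb.le hp0.le]

/-- Lower semicontinuity: the directional energy of the limit is at most the lower limit of the
difference quotients. -/
theorem dirEnergy_le_liminf_diffQuotient {p : ℝ} (hp : 1 ≤ p) {u : ℕ → Rn N → ℝ} {u₀ : Rn N → ℝ}
    (hu : ∀ k, MemLp (u k) (expo p)) (hu₀ : MemLp u₀ (expo p)) (h : TendstoLp p u u₀) {b : ℕ → ℝ}
    (hb : Tendsto b atTop atTop) (w : Rn N) :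
    dirEnergy p u₀ w ≤ liminf (fun k => diffQuotient p (b k) (u k) w) atTop := by
  have hp0 : 0 < p := by linarith
  have hfm : ∀ k, AEStronglyMeasurable (fun x => b k * (u k (x + (b k)⁻¹ • w) - u k x)) volume :=
    fun k => (((memLp_comp_add (hu k) _).sub (hu k)).const_mul _).1
  unfold dirEnergy
  split_ifs with h1
  · subst h1
    refine iSup_le fun ⟨φ, hφ, hφ1⟩ => ?_
    have hlim := tendsto_integral_diffQuotient_mul hp hu hu₀ h hb w hφ.neg
    have e : -∫ x, u₀ x * fderiv ℝ (-φ) x w = ∫ x, u₀ x * fderiv ℝ φ x w := by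
      rw [← integral_neg]
      congr 1 with x
      rw [fderiv_neg]
      simp
    rw [e] at hlim
    rw [← (ENNReal.tendsto_ofReal hlim).liminf_eq]
    refine liminf_le_liminf ?_
    filter_upwards [hb.eventually_gt_atTop 0] with k hk
    have h2 : diffQuotient 1 (b k) (u k) w =
        ∫⁻ x, ‖b k * (u k (x + (b k)⁻¹ • w) - u k x)‖ₑ := by
      have := eLpNorm_diffQuotient le_rfl hk (u k) w
      rw [expo, ENNReal.ofReal_one, eLpNorm_one_eq_lintegral_enorm, div_one, ENNReal.rpow_one] at this
      exact this.symm
    rw [h2]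
    refine (Real.ofReal_le_enorm _).trans ((enorm_integral_le_lintegral_enorm _).trans ?_)
    refine lintegral_mono fun x => ?_
    rw [enorm_mul]
    refine mul_le_of_le_one_right' ?_
    rw [← enorm_one (G := ℝ), enorm_le_iff_norm_le]
    simpa using hφ1 x
  · have hp1 : 1 < p := lt_of_le_of_ne hp (Ne.symm h1)
    have hpq := Real.HolderConjugate.conjExponent hp1
    set q := p.conjExponent
    -- Hölder bounds the pairings by `D_k^(1/p) ‖φ‖_q`. In the limit the distribution `w · Du₀` is
    -- bounded by `D^(1/p)` on `L^q`, hence is a function with the required norm.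
    set D := liminf (fun k => diffQuotient p (b k) (u k) w) atTop
    rcases eq_or_ne D ⊤ with hD | hD
    · rw [hD]
      exact le_top
    have hloc := locallyIntegrable_of_memLp hp hu₀
    have hrep : ∃ g : Rn N → ℝ, MemLp g (expo p) ∧ ∫⁻ x, ‖g x‖ₑ ^ p ≤ (D ^ (1 / p)) ^ p ∧
        ∀ φ, IsTest φ → -∫ x, u₀ x * fderiv ℝ φ x w = ∫ x, g x * φ x := by
      refine exists_representation_of_test_bound (N := N) hpq (C := D ^ (1 / p))
        (T := fun φ => -∫ x, u₀ x * fderiv ℝ φ x w)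
        (ENNReal.rpow_ne_top_of_nonneg (by positivity) hD) ?_ ?_ ?_
      · intro φ ψ hφ hψ
        rw [← neg_add, ← integral_add ((hφ.fderiv_apply w).integrable_mul hloc)
          ((hψ.fderiv_apply w).integrable_mul hloc)]
        congr 2 with x
        rw [fderiv_add (hφ.differentiable x) (hψ.differentiable x)]
        simp [mul_add]
      · intro c φ hφ
        rw [mul_neg, ← integral_const_mul]
        congr 2 with x
        rw [fderiv_const_smul (hφ.differentiable x)]
        simp
        ring
      · intro φ hφ
        have hlim := (tendsto_integral_diffQuotient_mul hp hu hu₀ h hb w hφ).enorm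
        -- A monotone continuous map commutes with `liminf`; the sequence `D_k` need not converge.
        have hmono : Monotone fun t : ℝ≥0∞ => t ^ (1 / p) * eLpNorm φ (ENNReal.ofReal q) volume :=
          fun s t hst => mul_le_mul_left (ENNReal.rpow_le_rpow hst (by positivity)) _
        have hcont : Continuous fun t : ℝ≥0∞ => t ^ (1 / p) * eLpNorm φ (ENNReal.ofReal q) volume :=
          (ENNReal.continuous_mul_const (hφ.memLp _).eLpNorm_ne_top).comp
            (ENNReal.continuous_rpow_const (y := 1 / p))
        have hmap := hmono.map_liminf_of_continuousAt
          (fun k => diffQuotient p (b k) (u k) w) (F := atTop) hcont.continuousAt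
        rw [hmap, ← hlim.liminf_eq]
        refine liminf_le_liminf ?_
        filter_upwards [hb.eventually_gt_atTop 0] with k hk
        simp only [Function.comp]
        rw [← eLpNorm_diffQuotient hp hk]
        exact enorm_integral_mul_le hpq (hfm k) hφ.continuous.aestronglyMeasurable
    obtain ⟨g, hgL, hgp, hg⟩ := hrep
    rw [← ENNReal.rpow_mul, one_div, inv_mul_cancel₀ hp0.ne', ENNReal.rpow_one] at hgp
    have hwd : HasWeakDirDeriv u₀ w g := fun φ hφ => by rw [← hg φ hφ, neg_neg]
    exact (iInf_le (fun g : {g : Rn N → ℝ // MemLp g (expo p) ∧ HasWeakDirDeriv u₀ w g} =>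
      ∫⁻ x, ‖g.1 x‖ₑ ^ p) ⟨g, hgL, hwd⟩).trans hgp

theorem tendstoLp_const {p : ℝ} (u : Rn N → ℝ) : TendstoLp p (fun _ => u) u := by
  simp [TendstoLp]

/-- The directional energy is the limit of difference quotients. -/
theorem tendsto_diffQuotient {p : ℝ} (hp : 1 ≤ p) {u : Rn N → ℝ} (hu : MemLp u (expo p))
    (w : Rn N) : Tendsto (fun b => diffQuotient p b u w) atTop (𝓝 (dirEnergy p u w)) := by
  refine tendsto_of_seq_tendsto fun b hb => ?_
  refine tendsto_of_le_liminf_of_limsup_le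
    (dirEnergy_le_liminf_diffQuotient hp (fun _ => hu) hu (tendstoLp_const u) hb w) ?_
  refine limsup_le_of_le (h := ?_)
  filter_upwards [hb.eventually_gt_atTop 0] with k hk
  exact diffQuotient_le_dirEnergy hp hu hk w

/-! ### Measurability and algebra of the directional energy -/

theorem diffQuotient_congr {u v : Rn N → ℝ} (h : u =ᵐ[volume] v) (p b : ℝ) (w : Rn N) :
    diffQuotient p b u w = diffQuotient p b v w := by
  unfold diffQuotient
  congr 1
  refine lintegral_congr_ae ?_
  have h' : ∀ᵐ x, u (x + b⁻¹ • w) = v (x + b⁻¹ • w) :=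
    (measurePreserving_add_right volume (b⁻¹ • w)).quasiMeasurePreserving.ae h
  filter_upwards [h, h'] with x h1 h2
  rw [h1, h2]

theorem measurable_diffQuotient (p b : ℝ) {u : Rn N → ℝ} (hu : AEStronglyMeasurable u volume) :
    Measurable (diffQuotient p b u) := by
  obtain ⟨v, hv, huv⟩ := hu
  have hvm := hv.measurable
  rw [show diffQuotient p b u = diffQuotient p b v from
    funext fun w => diffQuotient_congr huv p b w]
  unfold diffQuotient
  refine Measurable.const_mul (Measurable.lintegral_prod_right'
    (f := fun z : Rn N × Rn N => ‖v (z.2 + b⁻¹ • z.1) - v z.2‖ₑ ^ p) ?_) _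
  have h1 : Measurable fun z : Rn N × Rn N => v (z.2 + b⁻¹ • z.1) :=
    hvm.comp (by fun_prop : Continuous fun z : Rn N × Rn N => z.2 + b⁻¹ • z.1).measurable
  exact ((h1.sub (hvm.comp measurable_snd)).enorm).pow_const p

/-- The definition involves an uncountable supremum or infimum; measurability in the direction comes
from the pointwise limit of difference quotients. Homogeneity, evenness and quasi-subadditivity
below are obtained from the same limit, infinite values included. -/
theorem measurable_dirEnergy {p : ℝ} (hp : 1 ≤ p) {u : Rn N → ℝ} (hu : MemLp u (expo p)) :
    Measurable (dirEnergy p u) :=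
  measurable_of_tendsto_metrizable (f := fun n : ℕ => diffQuotient p n u)
    (fun n => measurable_diffQuotient p n hu.1) <| tendsto_pi_nhds.2 fun w =>
      (tendsto_diffQuotient hp hu w).comp tendsto_natCast_atTop_atTop

theorem diffQuotient_smul {p : ℝ} {b c : ℝ} (hb : 0 < b) (hc : 0 < c)
    (u : Rn N → ℝ) (w : Rn N) :
    diffQuotient p b u (c • w) = ENNReal.ofReal (c ^ p) * diffQuotient p (b / c) u w := by
  unfold diffQuotient
  rw [← mul_assoc, ← ENNReal.ofReal_mul (by positivity), ← Real.mul_rpow hc.le (by positivity),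
    mul_div_cancel₀ _ hc.ne']
  have h : (b / c)⁻¹ = b⁻¹ * c := by rw [inv_div, div_eq_inv_mul]
  simp only [smul_smul, h]

theorem dirEnergy_smul {p : ℝ} (hp : 1 ≤ p) {u : Rn N → ℝ} (hu : MemLp u (expo p)) {c : ℝ}
    (hc : 0 < c) (w : Rn N) :
    dirEnergy p u (c • w) = ENNReal.ofReal (c ^ p) * dirEnergy p u w := by
  have h1 := tendsto_diffQuotient hp hu (c • w)
  have h2 := ENNReal.Tendsto.const_mul (a := ENNReal.ofReal (c ^ p))
    ((tendsto_diffQuotient hp hu w).comp (tendsto_id.atTop_div_const hc))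
    (Or.inr ENNReal.ofReal_ne_top)
  refine tendsto_nhds_unique h1 (h2.congr' ?_)
  filter_upwards [eventually_gt_atTop 0] with b hb
  exact (diffQuotient_smul hb hc u w).symm

theorem dirEnergy_zero {p : ℝ} (hp : 1 ≤ p) {u : Rn N → ℝ} (hu : MemLp u (expo p)) :
    dirEnergy p u 0 = 0 := by
  have hp0 : 0 < p := by linarith
  refine tendsto_nhds_unique (tendsto_diffQuotient hp hu 0) ?_
  simp [diffQuotient, hp0]

theorem diffQuotient_neg (p b : ℝ) (u : Rn N → ℝ) (w : Rn N) :
    diffQuotient p b u (-w) = diffQuotient p b u w := by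
  unfold diffQuotient
  congr 1
  rw [← lintegral_add_right_eq_self _ (b⁻¹ • w)]
  refine lintegral_congr fun x => ?_
  rw [smul_neg, add_neg_cancel_right, ← enorm_neg, neg_sub]

theorem dirEnergy_neg {p : ℝ} (hp : 1 ≤ p) {u : Rn N → ℝ} (hu : MemLp u (expo p)) (w : Rn N) :
    dirEnergy p u (-w) = dirEnergy p u w :=
  tendsto_nhds_unique (tendsto_diffQuotient hp hu (-w)) <| by
    simpa only [diffQuotient_neg] using tendsto_diffQuotient hp hu w

/-- Move by `w`, then by `v`, and use convexity of `t ^ p`. The constant is harmless: only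
finiteness is drawn from it. -/
theorem diffQuotient_add_le {p : ℝ} (hp : 1 ≤ p) (b : ℝ) {u : Rn N → ℝ}
    (hu : AEStronglyMeasurable u volume) (v w : Rn N) :
    diffQuotient p b u (v + w) ≤ 2 ^ (p - 1) * (diffQuotient p b u v + diffQuotient p b u w) := by
  unfold diffQuotient
  have hm : ∀ y : Rn N, AEMeasurable (fun x => ‖u (x + y) - u x‖ₑ ^ p) volume := fun y =>
    (((hu.comp_measurePreserving (measurePreserving_add_right volume y)).sub hu).enorm).pow_const p
  have h1 : ∫⁻ x, ‖u (x + b⁻¹ • (v + w)) - u x‖ₑ ^ p ≤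
      2 ^ (p - 1) * ((∫⁻ x, ‖u (x + b⁻¹ • v) - u x‖ₑ ^ p) + ∫⁻ x, ‖u (x + b⁻¹ • w) - u x‖ₑ ^ p) := by
    rw [← lintegral_add_right_eq_self (fun x => ‖u (x + b⁻¹ • v) - u x‖ₑ ^ p) (b⁻¹ • w),
      ← lintegral_add_right' _ (hm _), ← lintegral_const_mul' _ _
      (ENNReal.rpow_ne_top_of_nonneg (by linarith) ENNReal.ofNat_ne_top)]
    refine lintegral_mono fun x => ?_
    refine le_trans ?_ (ENNReal.rpow_add_le_mul_rpow_add_rpow _ _ hp)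
    refine ENNReal.rpow_le_rpow ?_ (by linarith)
    refine le_trans (le_of_eq ?_) (enorm_add_le _ _)
    congr 1
    rw [smul_add, add_assoc, add_comm (b⁻¹ • w) (b⁻¹ • v)]
    ring
  calc _ ≤ ENNReal.ofReal (b ^ p) * (2 ^ (p - 1) * ((∫⁻ x, ‖u (x + b⁻¹ • v) - u x‖ₑ ^ p) +
        ∫⁻ x, ‖u (x + b⁻¹ • w) - u x‖ₑ ^ p)) := by gcongr
    _ = _ := by ring

theorem dirEnergy_add_le {p : ℝ} (hp : 1 ≤ p) {u : Rn N → ℝ} (hu : MemLp u (expo p))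
    (v w : Rn N) :
    dirEnergy p u (v + w) ≤ 2 ^ (p - 1) * (dirEnergy p u v + dirEnergy p u w) :=
  le_of_tendsto_of_tendsto' (tendsto_diffQuotient hp hu (v + w))
    (ENNReal.Tendsto.const_mul
      ((tendsto_diffQuotient hp hu v).add (tendsto_diffQuotient hp hu w))
      (Or.inr (ENNReal.rpow_ne_top_of_nonneg (by linarith) ENNReal.ofNat_ne_top)))
    fun b => diffQuotient_add_le hp b hu.1 v w

/-- The nonlocal energy is an average of difference quotients. -/
theorem nonlocalEnergy_eq_lintegral {p b : ℝ} (hb : 0 < b) {K : Rn N → ℝ≥0∞}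
    (hK : AEMeasurable K volume) {u : Rn N → ℝ} (hu : AEStronglyMeasurable u volume) :
    nonlocalEnergy p K b u = ∫⁻ w, diffQuotient p b u w * K w := by
  obtain ⟨v, hv, huv⟩ := hu
  have hvm := hv.measurable
  obtain ⟨K', hK', hKK'⟩ := hK
  have h1 : ∀ y, ∫⁻ x, ‖u x - u y‖ₑ ^ p * rescaledKernel K b (x - y) =
      ∫⁻ w, ‖u (y + b⁻¹ • w) - u y‖ₑ ^ p * K w := by
    intro y
    -- Substitute `x = y + b⁻¹ w`; the Jacobian cancels the factor `b ^ N` of the rescaled kernel.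
    rw [← lintegral_add_left_eq_self _ y]
    simp only [add_sub_cancel_left, rescaledKernel]
    have hmap := Measure.map_addHaar_smul (volume : Measure (Rn N)) (inv_ne_zero hb.ne')
    have hemb : MeasurableEmbedding fun w : Rn N => b⁻¹ • w :=
      (Homeomorph.smulOfNeZero b⁻¹ (inv_ne_zero hb.ne')).measurableEmbedding
    have h2 := hemb.lintegral_map (μ := volume)
      (fun x => ‖u (y + x) - u y‖ₑ ^ p * (ENNReal.ofReal (b ^ N) * K (b • x)))
    rw [hmap, lintegral_smul_measure] at h2
    simp only [smul_inv_smul₀ hb.ne', finrank_euclideanSpace, Fintype.card_fin] at h2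
    have hc : |((b⁻¹) ^ N)⁻¹| = b ^ N := by
      rw [inv_pow, inv_inv, abs_of_pos (by positivity)]
    rw [hc, smul_eq_mul] at h2
    have h3 : ∀ x, ‖u (y + b⁻¹ • x) - u y‖ₑ ^ p * (ENNReal.ofReal (b ^ N) * K x) =
        ENNReal.ofReal (b ^ N) * (‖u (y + b⁻¹ • x) - u y‖ₑ ^ p * K x) := fun x => by ring
    simp_rw [h3] at h2
    rw [lintegral_const_mul' _ _ ENNReal.ofReal_ne_top] at h2
    refine (ENNReal.mul_right_inj ?_ ENNReal.ofReal_ne_top).1 h2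
    exact (ENNReal.ofReal_pos.2 (by positivity)).ne'
  unfold nonlocalEnergy
  simp_rw [h1]
  -- Tonelli needs joint measurability, so `u` and `K` are exchanged for measurable representatives;
  -- translations and dilations preserve null sets.
  have h4 : ∀ᵐ y, ∫⁻ w, ‖u (y + b⁻¹ • w) - u y‖ₑ ^ p * K w =
      ∫⁻ w, ‖v (y + b⁻¹ • w) - v y‖ₑ ^ p * K' w := by
    filter_upwards [huv] with y hy
    refine lintegral_congr_ae ?_
    have h5 : ∀ᵐ w, u (y + b⁻¹ • w) = v (y + b⁻¹ • w) := by
      have h6 : ∀ᵐ w, u (y + w) = v (y + w) :=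
        (measurePreserving_add_left volume y).quasiMeasurePreserving.ae huv
      have hq : Measure.QuasiMeasurePreserving (fun w : Rn N => b⁻¹ • w) volume volume := by
        refine ⟨(continuous_const_smul _).measurable, ?_⟩
        rw [Measure.map_addHaar_smul _ (inv_ne_zero hb.ne')]
        exact Measure.smul_absolutelyContinuous
      exact hq.ae h6
    filter_upwards [h5, hKK'] with w hw hKw
    rw [hw, hKw, hy]
  rw [lintegral_congr_ae h4, lintegral_lintegral_swap]
  · rw [← lintegral_const_mul' _ _ ENNReal.ofReal_ne_top]
    refine lintegral_congr_ae ?_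
    filter_upwards [hKK'] with w hw
    rw [hw, diffQuotient_congr huv, diffQuotient, lintegral_mul_const, mul_assoc]
    have h1 : Measurable fun x : Rn N => v (x + b⁻¹ • w) :=
      hvm.comp (by fun_prop : Continuous fun x : Rn N => x + b⁻¹ • w).measurable
    exact ((h1.sub hvm).enorm).pow_const p
  · have h1 : Measurable fun z : Rn N × Rn N => v (z.1 + b⁻¹ • z.2) :=
      hvm.comp (by fun_prop : Continuous fun z : Rn N × Rn N => z.1 + b⁻¹ • z.2).measurable
    exact ((((h1.sub (hvm.comp measurable_fst)).enorm).pow_const p).mul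
      (hK'.comp measurable_snd)).aemeasurable

/-! ### Polar coordinates -/

theorem lintegral_polar (hN : 1 ≤ N) {f : Rn N → ℝ≥0∞} (hf : Measurable f) :
    ∫⁻ x, f x = ∫⁻ σ : Metric.sphere (0 : Rn N) 1, (∫⁻ r in Ioi (0 : ℝ),
      ENNReal.ofReal (r ^ (N - 1)) * f (r • (σ : Rn N))) ∂(volume : Measure (Rn N)).toSphere := by
  have : NeZero N := ⟨by omega⟩
  have hmp := Measure.measurePreserving_homeomorphUnitSphereProd (volume : Measure (Rn N))
  rw [finrank_euclideanSpace, Fintype.card_fin] at hmp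
  have hg : Measurable fun z : Metric.sphere (0 : Rn N) 1 × Ioi (0 : ℝ) =>
      f ((z.2 : ℝ) • (z.1 : Rn N)) :=
    hf.comp (by fun_prop : Continuous fun z : Metric.sphere (0 : Rn N) 1 × Ioi (0 : ℝ) =>
      (z.2 : ℝ) • (z.1 : Rn N)).measurable
  have h1 := hmp.lintegral_comp hg
  have h2 : ∀ x : ({0}ᶜ : Set (Rn N)), (((homeomorphUnitSphereProd (Rn N)) x).2 : ℝ) •
      (((homeomorphUnitSphereProd (Rn N)) x).1 : Rn N) = x := by
    intro x
    rw [← homeomorphUnitSphereProd_symm_apply_coe, Homeomorph.symm_apply_apply]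
  simp_rw [h2] at h1
  -- Polar coordinates miss the origin, which is null because `N ≥ 1`.
  rw [lintegral_subtype_comap (measurableSet_singleton _).compl, restrict_compl_singleton] at h1
  rw [h1, lintegral_prod _ hg.aemeasurable]
  refine lintegral_congr fun σ => ?_
  rw [Measure.volumeIoiPow, lintegral_withDensity_eq_lintegral_mul_non_measurable _ (by fun_prop)
    (by simp)]
  exact lintegral_subtype_comap measurableSet_Ioi
    (fun r : ℝ => ENNReal.ofReal (r ^ (N - 1)) * f (r • (σ : Rn N)))

/-- A null set meets almost every ray in a null set. This justifies changing `K` on a null set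
inside `theta`, which integrates `K` along individual rays. -/
theorem ae_ae_smul_of_ae (hN : 1 ≤ N) {P : Rn N → Prop} (hP : ∀ᵐ x, P x) :
    ∀ᵐ σ : Metric.sphere (0 : Rn N) 1 ∂(volume : Measure (Rn N)).toSphere,
      ∀ᵐ r : ℝ ∂volume.restrict (Ioi 0), P (r • (σ : Rn N)) := by
  set T := toMeasurable volume {x | ¬ P x}
  have hT : MeasurableSet T := measurableSet_toMeasurable _ _
  have hT0 : volume T = 0 := by rw [measure_toMeasurable]; exact hP
  have hm : Measurable (T.indicator fun _ => (1 : ℝ≥0∞)) := measurable_const.indicator hT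
  have h := lintegral_polar hN hm
  rw [lintegral_indicator hT, setLIntegral_measure_zero _ _ hT0] at h
  have hmeas : Measurable fun z : Metric.sphere (0 : Rn N) 1 × ℝ =>
      ENNReal.ofReal (z.2 ^ (N - 1)) * T.indicator (fun _ => (1 : ℝ≥0∞)) (z.2 • (z.1 : Rn N)) := by
    refine Measurable.mul (by fun_prop) (hm.comp ?_)
    exact (by fun_prop : Continuous fun z : Metric.sphere (0 : Rn N) 1 × ℝ =>
      z.2 • (z.1 : Rn N)).measurable
  have h' := (lintegral_eq_zero_iff (hmeas.lintegral_prod_right' (ν := volume.restrict (Ioi 0)))).1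
    h.symm
  filter_upwards [h'] with σ hσ
  have h'' := (lintegral_eq_zero_iff (hmeas.comp measurable_prodMk_left)).1 hσ
  filter_upwards [h'', ae_restrict_mem measurableSet_Ioi] with r hr hr0
  by_contra hne
  have hmem : r • (σ : Rn N) ∈ T := subset_toMeasurable _ _ hne
  simp only [Function.comp, Pi.zero_apply, indicator_of_mem hmem, mul_one,
    ENNReal.ofReal_eq_zero] at hr
  exact absurd (pow_pos hr0 (N - 1)) (not_lt.2 hr)

theorem moment_ne_zero {p : ℝ} {K : Rn N → ℝ≥0∞} (hN : 1 ≤ N) (hK : AEMeasurable K volume)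
    (hKne : ¬ ∀ᵐ x : Rn N, K x = 0) : moment p K ≠ 0 := by
  have : NeZero N := ⟨by omega⟩
  intro h
  refine hKne ?_
  have h1 := (lintegral_eq_zero_iff' ((Measurable.aemeasurable (by fun_prop)).mul hK)).1 h
  have h2 : ∀ᵐ x : Rn N, x ≠ 0 := by simp [ae_iff]
  filter_upwards [h1, h2] with x hx hx0
  simp only [Pi.zero_apply, mul_eq_zero, Pi.mul_apply] at hx
  refine hx.resolve_left ?_
  have := norm_pos_iff.2 hx0
  exact (ENNReal.ofReal_pos.2 (by positivity)).ne'

/-- The anisotropic energy as an average of the directional energies. -/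
theorem moment_mul_anisotropicEnergy {p : ℝ} (hp : 1 ≤ p) (hN : 1 ≤ N) {K : Rn N → ℝ≥0∞}
    (hK : AEMeasurable K volume) (hM0 : moment p K ≠ 0) (hM : moment p K ≠ ⊤) {u : Rn N → ℝ}
    (hu : MemLp u (expo p)) :
    moment p K * anisotropicEnergy p K u = ∫⁻ w, dirEnergy p u w * K w := by
  have hd := measurable_dirEnergy hp hu
  obtain ⟨K', hK', hKK'⟩ := hK
  have h1 : ∫⁻ w, dirEnergy p u w * K w = ∫⁻ w, dirEnergy p u w * K' w := by
    refine lintegral_congr_ae ?_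
    filter_upwards [hKK'] with w hw
    rw [hw]
  rw [h1, lintegral_polar (f := fun w => dirEnergy p u w * K' w) hN (hd.mul hK'), anisotropicEnergy, ← lintegral_const_mul' _ _ hM]
  refine lintegral_congr_ae ?_
  filter_upwards [ae_ae_smul_of_ae hN hKK'] with σ hσ
  have h2 : ∫⁻ r in Ioi (0 : ℝ), ENNReal.ofReal (r ^ ((N : ℝ) + p - 1)) * K (r • (σ : Rn N)) =
      ∫⁻ r in Ioi (0 : ℝ), ENNReal.ofReal (r ^ ((N : ℝ) + p - 1)) * K' (r • (σ : Rn N)) := by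
    refine lintegral_congr_ae ?_
    filter_upwards [hσ] with r hr
    rw [hr]
  rw [theta, h2, mul_left_comm, ENNReal.mul_div_cancel hM0 hM]
  have hm : Measurable fun r : ℝ => ENNReal.ofReal (r ^ ((N : ℝ) + p - 1)) * K' (r • (σ : Rn N)) := by
    refine Measurable.mul (by fun_prop) (hK'.comp ?_)
    exact (by fun_prop : Continuous fun r : ℝ => r • (σ : Rn N)).measurable
  rw [← lintegral_const_mul _ hm]
  refine setLIntegral_congr_fun measurableSet_Ioi fun r hr => ?_
  have hr0 : 0 < r := hr
  rw [dirEnergy_smul hp hu hr0]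
  -- The weight of `theta` is the polar Jacobian `r ^ (N - 1)` times the homogeneity factor `r ^ p`.
  have e : ENNReal.ofReal (r ^ ((N : ℝ) + p - 1)) =
      ENNReal.ofReal (r ^ (N - 1)) * ENNReal.ofReal (r ^ p) := by
    rw [← ENNReal.ofReal_mul (by positivity), ← Real.rpow_natCast, ← Real.rpow_add hr0,
      Nat.cast_sub hN]
    congr 2
    push_cast
    ring
  rw [e]
  ring

/-! ### Finiteness of the energy -/

/-- The directions in which the energy is finite. -/
def finiteDirections {p : ℝ} (hp : 1 ≤ p) {u : Rn N → ℝ} (hu : MemLp u (expo p)) :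
    Submodule ℝ (Rn N) where
  carrier := {w | dirEnergy p u w < ⊤}
  zero_mem' := by simp [dirEnergy_zero hp hu]
  add_mem' {v w} hv hw := (dirEnergy_add_le hp hu v w).trans_lt <|
    ENNReal.mul_lt_top (ENNReal.rpow_lt_top_of_nonneg (by linarith) ENNReal.ofNat_ne_top)
      (ENNReal.add_lt_top.2 ⟨hv, hw⟩)
  -- Homogeneity is available for positive scalars only; evenness supplies the negative ones.
  smul_mem' c w hw := by
    have hpos : ∀ c : ℝ, 0 < c → dirEnergy p u (c • w) < ⊤ := fun c hc => by
      rw [dirEnergy_smul hp hu hc]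
      exact ENNReal.mul_lt_top ENNReal.ofReal_lt_top hw
    rcases lt_trichotomy c 0 with hc | rfl | hc
    · have := hpos (-c) (by linarith)
      rwa [neg_smul, dirEnergy_neg hp hu] at this
    · simp [dirEnergy_zero hp hu]
    · exact hpos c hc

/-- If the finite directions formed a proper subspace, they would be a null set. The energy would be
infinite at almost every `w`, and finiteness of the integral would force `K = 0` a.e. -/
theorem dirEnergy_lt_top_of_lintegral {p : ℝ} (hp : 1 ≤ p) {K : Rn N → ℝ≥0∞}
    (hK : AEMeasurable K volume) (hKne : ¬ ∀ᵐ x : Rn N, K x = 0) {u : Rn N → ℝ}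
    (hu : MemLp u (expo p)) (h : ∫⁻ w, dirEnergy p u w * K w < ⊤) (w : Rn N) :
    dirEnergy p u w < ⊤ := by
  suffices hV : finiteDirections hp hu = ⊤ by
    have : w ∈ finiteDirections hp hu := hV ▸ Submodule.mem_top
    exact this
  by_contra hV
  refine hKne ?_
  have h0 := Measure.addHaar_submodule volume (finiteDirections hp hu) hV
  have h1 : ∀ᵐ x : Rn N, x ∉ finiteDirections hp hu := by
    rw [ae_iff]
    simpa using h0
  have h2 := ae_lt_top' ((measurable_dirEnergy hp hu).aemeasurable.mul hK) h.ne
  filter_upwards [h1, h2] with x hx hx2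
  by_contra hKx
  have : dirEnergy p u x = ⊤ := not_lt_top_iff.1 hx
  simp only [Pi.mul_apply] at hx2
  rw [this, ENNReal.top_mul hKx] at hx2
  exact lt_irrefl _ hx2

theorem IsTest.coord {Φ : Rn N → Rn N} (h : IsTest Φ) (i : Fin N) : IsTest fun x => Φ x i :=
  ⟨contDiff_euclidean.1 h.1 i,
    h.2.comp_left (g := fun y : Rn N => y i) rfl⟩

theorem fderiv_coord {Φ : Rn N → Rn N} (h : IsTest Φ) (i : Fin N) (x v : Rn N) :
    fderiv ℝ (fun x => Φ x i) x v = fderiv ℝ Φ x v i := by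
  have h1 := (EuclideanSpace.proj (𝕜 := ℝ) i).hasFDerivAt.comp x (h.differentiable x).hasFDerivAt
  have h2 : HasFDerivAt (fun x => Φ x i)
    ((EuclideanSpace.proj (𝕜 := ℝ) i).comp (fderiv ℝ Φ x)) x := h1
  rw [h2.fderiv]
  rfl

theorem totalVariation_le_sum {u : Rn N → ℝ} (hu : LocallyIntegrable u) :
    totalVariation u ≤ ∑ i : Fin N, dirVariation u (EuclideanSpace.single i 1) := by
  refine iSup_le fun ⟨Φ, hΦ, hΦ1⟩ => ?_
  have h1 : ∫ x, u x * divergence Φ x =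
      ∑ i : Fin N, ∫ x, u x * fderiv ℝ (fun x => Φ x i) x (EuclideanSpace.single i 1) := by
    rw [← integral_finsetSum _ fun i _ =>
      ((hΦ.coord i).fderiv_apply (EuclideanSpace.single i 1)).integrable_mul hu]
    congr 1 with x
    rw [divergence, Finset.mul_sum]
    simp_rw [fderiv_coord hΦ]
  dsimp only
  rw [h1]
  refine (Finset.le_sum_of_subadditive ENNReal.ofReal ENNReal.ofReal_zero.le
    (fun _ _ => ENNReal.ofReal_add_le) _ _).trans (Finset.sum_le_sum fun i _ => ?_)
  exact le_iSup (fun φ : {φ : Rn N → ℝ // IsTest φ ∧ ∀ x, |φ x| ≤ 1} =>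
      ENNReal.ofReal (∫ x, u x * fderiv ℝ φ.1 x (EuclideanSpace.single i 1)))
      ⟨fun x => Φ x i, hΦ.coord i, fun x => (PiLp.norm_apply_le (Φ x) i).trans (hΦ1 x)⟩

theorem hasWeakGradient_of_coord {p : ℝ} (hp : 1 ≤ p) {u : Rn N → ℝ} (hu : LocallyIntegrable u)
    {g : Fin N → Rn N → ℝ} (hg : ∀ i, MemLp (g i) (expo p))
    (h : ∀ i, HasWeakDirDeriv u (EuclideanSpace.single i 1) (g i)) :
    HasWeakGradient u fun x => ∑ i, g i x • EuclideanSpace.single i (1 : ℝ) := by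
  intro v φ hφ
  have e1 : ∀ x, u x * fderiv ℝ φ x v =
      ∑ i, v i * (u x * fderiv ℝ φ x (EuclideanSpace.single i 1)) := by
    intro x
    have hv : v = ∑ i, v i • EuclideanSpace.single i (1 : ℝ) := by
      ext j
      simp [Finset.sum_apply, Pi.single_apply]
    conv_lhs => rw [hv, map_sum, Finset.mul_sum]
    refine Finset.sum_congr rfl fun i _ => ?_
    rw [map_smul, smul_eq_mul]
    ring
  have e2 : ∀ x, inner ℝ (∑ i, g i x • EuclideanSpace.single i (1 : ℝ)) v * φ x =
      ∑ i, v i * (g i x * φ x) := by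
    intro x
    rw [sum_inner, Finset.sum_mul]
    refine Finset.sum_congr rfl fun i _ => ?_
    rw [real_inner_smul_left, EuclideanSpace.inner_single_left]
    simp
    ring
  simp_rw [e1, e2]
  rw [integral_finsetSum _ fun i _ => ((hφ.fderiv_apply _).integrable_mul hu).const_mul _,
    integral_finsetSum _ fun i _ =>
      (hφ.integrable_mul (locallyIntegrable_of_memLp hp (hg i))).const_mul _,
    ← Finset.sum_neg_distrib]
  refine Finset.sum_congr rfl fun i _ => ?_
  rw [integral_const_mul, integral_const_mul, h i φ hφ, mul_neg]

/-- Only coordinate directions are needed: they assemble the weak gradient for `p > 1` and bound the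
total variation by a sum for `p = 1`. -/
theorem mem_sobolevBV_of_dirEnergy {p : ℝ} (hp : 1 ≤ p) {u : Rn N → ℝ}
    (hu : MemLp u (expo p)) (h : ∀ w, dirEnergy p u w < ⊤) : u ∈ sobolevBV N p := by
  have hloc := locallyIntegrable_of_memLp hp hu
  refine ⟨hu, ?_⟩
  unfold dirEnergy at h
  split_ifs at h ⊢ with h1
  · exact (totalVariation_le_sum hloc).trans_lt (ENNReal.sum_lt_top.2 fun i _ => h _)
  · have hex : ∀ i : Fin N, ∃ g : Rn N → ℝ, MemLp g (expo p) ∧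
        HasWeakDirDeriv u (EuclideanSpace.single i 1) g := by
      intro i
      obtain ⟨⟨g, hg⟩, -⟩ := iInf_lt_iff.1 (h (EuclideanSpace.single i 1))
      exact ⟨g, hg⟩
    choose g hgL hg using hex
    refine ⟨_, ?_, hasWeakGradient_of_coord hp hloc hgL hg⟩
    exact memLp_finsetSum _ fun i _ =>
      (ContinuousLinearMap.toSpanSingleton ℝ (EuclideanSpace.single i (1 : ℝ))).comp_memLp' (hgL i)

/-! ### Convergence -/

theorem nonlocalEnergy_le_lintegral_dirEnergy {p : ℝ} (hp : 1 ≤ p) {K : Rn N → ℝ≥0∞}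
    (hK : AEMeasurable K volume) {u : Rn N → ℝ} (hu : MemLp u (expo p)) {b : ℝ} (hb : 0 < b) :
    nonlocalEnergy p K b u ≤ ∫⁻ w, dirEnergy p u w * K w := by
  rw [nonlocalEnergy_eq_lintegral hb hK hu.1]
  exact lintegral_mono fun w => mul_le_mul_left (diffQuotient_le_dirEnergy hp hu hb w) _

/-- Fatou's lemma in `w` applied to the directional lower semicontinuity. -/
theorem lintegral_dirEnergy_le_liminf_nonlocalEnergy {p : ℝ} (hp : 1 ≤ p) {K : Rn N → ℝ≥0∞}
    (hK : AEMeasurable K volume) {u : ℕ → Rn N → ℝ} {u₀ : Rn N → ℝ}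
    (hu : ∀ k, MemLp (u k) (expo p)) (hu₀ : MemLp u₀ (expo p)) (h : TendstoLp p u u₀) {b : ℕ → ℝ}
    (hb : Tendsto b atTop atTop) :
    ∫⁻ w, dirEnergy p u₀ w * K w ≤ liminf (fun k => nonlocalEnergy p K (b k) (u k)) atTop := by
  calc ∫⁻ w, dirEnergy p u₀ w * K w
      ≤ ∫⁻ w, liminf (fun k => diffQuotient p (b k) (u k) w * K w) atTop := by
        refine lintegral_mono fun w => ?_
        have h1 := dirEnergy_le_liminf_diffQuotient hp hu hu₀ h hb w
        have h2 := ENNReal.le_liminf_mul (f := atTop)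
          (u := fun k => diffQuotient p (b k) (u k) w) (v := fun _ => K w)
        rw [liminf_const] at h2
        exact (mul_le_mul_left h1 _).trans h2
    _ ≤ liminf (fun k => ∫⁻ w, diffQuotient p (b k) (u k) w * K w) atTop :=
        lintegral_liminf_le' fun k => ((measurable_diffQuotient p _ (hu k).1).aemeasurable).mul hK
    _ = liminf (fun k => nonlocalEnergy p K (b k) (u k)) atTop := by
        refine liminf_congr ?_
        filter_upwards [hb.eventually_gt_atTop 0] with k hk
        rw [nonlocalEnergy_eq_lintegral hk hK (hu k).1]

/-- Convergence and coercivity for any functional that agrees on `L^p` with the average of the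
directional energies. -/
theorem convergesWithCoercivity_of_eq {p : ℝ} (hp : 1 ≤ p) {K : Rn N → ℝ≥0∞}
    (hK : AEMeasurable K volume) (hKne : ¬ ∀ᵐ x : Rn N, K x = 0) {β : ℝ → ℝ}
    (hβpos : ∀ t ∈ Ioo (0 : ℝ) 1, 0 < β t) (hβ : Tendsto β (𝓝[>] 0) atTop)
    {G : (Rn N → ℝ) → ℝ≥0∞}
    (hG : ∀ u, MemLp u (expo p) → G u = ∫⁻ w, dirEnergy p u w * K w) :
    ConvergesWithCoercivity p (fun t u => nonlocalEnergy p K (β t) u) G := by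
  have hmem : ∀ u₀ : Rn N → ℝ, MemLp u₀ (expo p) → ∀ u : ℕ → Rn N → ℝ,
      (∀ k, MemLp (u k) (expo p)) → TendstoLp p u u₀ → ∀ b : ℕ → ℝ, Tendsto b atTop atTop →
      liminf (fun k => nonlocalEnergy p K (b k) (u k)) atTop < ⊤ → u₀ ∈ sobolevBV N p := by
    intro u₀ hu₀ u hu h b hb hlt
    exact mem_sobolevBV_of_dirEnergy hp hu₀ (dirEnergy_lt_top_of_lintegral hp hK hKne hu₀
      ((lintegral_dirEnergy_le_liminf_nonlocalEnergy hp hK hu hu₀ h hb).trans_lt hlt))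
  refine ⟨fun u hu => ?_, fun t ht ht0 => ?_, ?_⟩
  · have huL : MemLp u (expo p) := hu.1
    refine tendsto_of_seq_tendsto fun t ht => ?_
    rw [hG u huL]
    have hb : Tendsto (fun k => β (t k)) atTop atTop := hβ.comp ht
    refine tendsto_of_le_liminf_of_limsup_le
      (lintegral_dirEnergy_le_liminf_nonlocalEnergy hp hK (fun _ => huL) huL
        (tendstoLp_const u) hb) ?_
    refine limsup_le_of_le (h := ?_)
    filter_upwards [hb.eventually_gt_atTop 0] with k hk
    exact nonlocalEnergy_le_lintegral_dirEnergy hp hK huL hk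
  · have hb : Tendsto (fun k => β (t k)) atTop atTop :=
      hβ.comp (tendsto_nhdsWithin_iff.2 ⟨ht0, Eventually.of_forall fun k => (ht k).1⟩)
    refine ⟨⟨fun u u₀ hu hu₀ h => ?_, fun u₀ hu₀ => ?_⟩, fun u u₀ hu hu₀ h hlt => ?_⟩
    · rw [hG u₀ hu₀.1]
      exact lintegral_dirEnergy_le_liminf_nonlocalEnergy hp hK hu hu₀.1 h hb
    -- Constant recovery sequence: the upper bound holds at every scale.
    · refine ⟨fun _ => u₀, fun _ => hu₀, tendstoLp_const u₀, ?_⟩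
      rw [hG u₀ hu₀.1]
      exact limsup_le_of_le (h := Eventually.of_forall fun k =>
        nonlocalEnergy_le_lintegral_dirEnergy hp hK hu₀.1 (hβpos _ (ht k)))
    · exact hmem u₀ hu₀ u hu h _ hb hlt
  · intro u u₀ hu hu₀ h hlt
    -- For the constant sequence `G`, insert the nonlocal energies with parameter `k`: they lie
    -- below `G` and are already known to be coercive.
    refine hmem u₀ hu₀ u hu h (fun k => (k : ℝ)) tendsto_natCast_atTop_atTop ?_
    refine lt_of_le_of_lt (liminf_le_liminf ?_) hlt
    filter_upwards [eventually_gt_atTop 0] with k hk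
    rw [hG _ (hu k)]
    exact nonlocalEnergy_le_lintegral_dirEnergy hp hK (hu k) (by exact_mod_cast hk)

/-! ### Radial kernels -/

/-- The `p`-th moment of `K` in the direction `a`. -/
noncomputable def dirMoment (p : ℝ) (K : Rn N → ℝ≥0∞) (a : Rn N) : ℝ≥0∞ :=
  ∫⁻ w, ‖inner ℝ a w‖ₑ ^ p * K w

theorem dirMoment_isometry {p : ℝ} {K : Rn N → ℝ≥0∞} (hK : IsRadial K)
    (R : Rn N ≃ₗᵢ[ℝ] Rn N) (a : Rn N) : dirMoment p K (R a) = dirMoment p K a := by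
  obtain ⟨k, hk⟩ := hK
  have hR := R.measurePreserving
  have hemb : MeasurableEmbedding R := R.toHomeomorph.measurableEmbedding
  unfold dirMoment
  rw [← hR.lintegral_comp_emb hemb]
  refine lintegral_congr_ae ?_
  filter_upwards [hk, hR.quasiMeasurePreserving.ae hk] with w h1 h2
  rw [h1, h2, R.norm_map, R.inner_map_map]

theorem dirMoment_smul {p : ℝ} (hp : 0 < p) (K : Rn N → ℝ≥0∞) (c : ℝ) (a : Rn N) :
    dirMoment p K (c • a) = ‖c‖ₑ ^ p * dirMoment p K a := by
  unfold dirMoment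
  rw [← lintegral_const_mul' _ _ (ENNReal.rpow_ne_top_of_nonneg hp.le enorm_ne_top)]
  refine lintegral_congr fun w => ?_
  rw [real_inner_smul_left, enorm_mul, ENNReal.mul_rpow_of_nonneg _ _ hp.le, mul_assoc]

/-- Radial symmetry makes the moment depend only on `‖a‖`: a reflection carries `‖a‖ • e` to `a`. -/
theorem dirMoment_eq {p : ℝ} (hp : 0 < p) {K : Rn N → ℝ≥0∞} (hK : IsRadial K) {e : Rn N}
    (he : ‖e‖ = 1) (a : Rn N) : dirMoment p K a = ‖a‖ₑ ^ p * dirMoment p K e := by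
  have h1 : ‖‖a‖ • e‖ = ‖a‖ := by rw [norm_smul, norm_norm, he, mul_one]
  have h2 := Submodule.reflection_sub h1
  rw [← enorm_norm, ← dirMoment_smul hp, ← dirMoment_isometry hK _ (‖a‖ • e), h2]

/-- The Gaussian kernel. -/
noncomputable def gaussianKernel (x : Rn N) : ℝ≥0∞ := ENNReal.ofReal (Real.exp (-‖x‖ ^ 2))

theorem isRadial_gaussianKernel : IsRadial (gaussianKernel (N := N)) :=
  ⟨fun r => ENNReal.ofReal (Real.exp (-r ^ 2)), Eventually.of_forall fun _ => rfl⟩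

theorem measurable_gaussianKernel : Measurable (gaussianKernel (N := N)) := by
  unfold gaussianKernel
  fun_prop

/-- Evaluate `∬ |a · w|^p K(w) γ(a) da dw`, `γ` the Gaussian, in both orders. The ratio of
directional to full moment is thus the same for `K` as for the Gaussian, where both are explicit. -/
theorem dirMoment_mul_moment_gaussianKernel {p : ℝ} (hp : 0 < p) {K : Rn N → ℝ≥0∞}
    (hKm : AEMeasurable K volume) (hK : IsRadial K) {e : Rn N} (he : ‖e‖ = 1) :
    dirMoment p K e * moment p (gaussianKernel (N := N)) =
      dirMoment p (gaussianKernel (N := N)) e * moment p K := by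
  have hnorm : ∀ x : Rn N, ‖x‖ₑ ^ p = ENNReal.ofReal (‖x‖ ^ p) := fun x => by
    rw [← ofReal_norm, ENNReal.ofReal_rpow_of_nonneg (norm_nonneg _) hp.le]
  have h1 : ∫⁻ a, dirMoment p K a * gaussianKernel a =
      dirMoment p K e * moment p (gaussianKernel (N := N)) := by
    unfold moment
    have hm : Measurable fun x : Rn N => ENNReal.ofReal (‖x‖ ^ p) * gaussianKernel x :=
      Measurable.mul (by fun_prop) measurable_gaussianKernel
    rw [← lintegral_const_mul _ hm]
    refine lintegral_congr fun a => ?_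
    rw [dirMoment_eq hp hK he, hnorm]
    ring
  have h2 : ∫⁻ w, dirMoment p (gaussianKernel (N := N)) w * K w =
      dirMoment p (gaussianKernel (N := N)) e * moment p K := by
    unfold moment
    have hm : AEMeasurable (fun x : Rn N => ENNReal.ofReal (‖x‖ ^ p) * K x) volume :=
      (Measurable.aemeasurable (by fun_prop)).mul hKm
    rw [← lintegral_const_mul'' _ hm]
    refine lintegral_congr fun a => ?_
    rw [dirMoment_eq hp isRadial_gaussianKernel he, hnorm]
    ring
  rw [← h1, ← h2]
  have hin : Measurable fun z : Rn N × Rn N => ‖inner ℝ z.1 z.2‖ₑ ^ p :=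
    (by fun_prop : Continuous fun z : Rn N × Rn N => inner ℝ z.1 z.2).measurable.enorm.pow_const p
  have e1 : ∀ a : Rn N, dirMoment p K a * gaussianKernel a =
      ∫⁻ w, ‖inner ℝ a w‖ₑ ^ p * K w * gaussianKernel a := fun a => by
    have hm : AEMeasurable (fun w => ‖inner ℝ a w‖ₑ ^ p * K w) volume :=
      (hin.comp measurable_prodMk_left).aemeasurable.mul hKm
    rw [dirMoment, lintegral_mul_const'' _ hm]
  have e2 : ∀ w : Rn N, dirMoment p (gaussianKernel (N := N)) w * K w =
      ∫⁻ a, ‖inner ℝ a w‖ₑ ^ p * K w * gaussianKernel a := fun w => by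
    have hm : Measurable fun a => ‖inner ℝ w a‖ₑ ^ p * gaussianKernel a :=
      (hin.comp measurable_prodMk_left).mul measurable_gaussianKernel
    rw [dirMoment, ← lintegral_mul_const _ hm]
    refine lintegral_congr fun a => ?_
    rw [real_inner_comm]
    ring
  simp_rw [e1, e2]
  refine lintegral_lintegral_swap ?_
  exact (hin.aemeasurable.mul (hKm.comp_quasiMeasurePreserving
    Measure.quasiMeasurePreserving_snd)).mul
    (measurable_gaussianKernel.comp measurable_fst).aemeasurable

/-- The integral of a non-integrable function is `0` by convention, so a positive value already
certifies integrability. -/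
theorem lintegral_ofReal_of_integral_pos {α : Type*} [MeasurableSpace α] {μ : Measure α}
    {f : α → ℝ} (hf : ∀ x, 0 ≤ f x) (h : 0 < ∫ x, f x ∂μ) :
    ∫⁻ x, ENNReal.ofReal (f x) ∂μ = ENNReal.ofReal (∫ x, f x ∂μ) :=
  (ofReal_integral_eq_lintegral_ofReal (not_imp_comm.1 integral_undef h.ne')
    (Eventually.of_forall hf)).symm

theorem moment_gaussianKernel (hN : 1 ≤ N) {p : ℝ} (hp : 0 < p) :
    moment p (gaussianKernel (N := N)) = ENNReal.ofReal
      (Real.sqrt Real.pi ^ N * Real.Gamma ((N + p) / 2) / Real.Gamma (N / 2)) := by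
  have : NeZero N := ⟨by omega⟩
  have hN0 : (0 : ℝ) < N := by exact_mod_cast hN
  have h1 : ∫ x : Rn N, ‖x‖ ^ p * Real.exp (-‖x‖ ^ 2) =
      Real.sqrt Real.pi ^ N * Real.Gamma ((N + p) / 2) / Real.Gamma (N / 2) := by
    rw [integral_fun_norm_addHaar volume fun r => r ^ p * Real.exp (-r ^ 2)]
    have h2 : ∫ y in Ioi (0 : ℝ), y ^ (Module.finrank ℝ (Rn N) - 1) • (y ^ p * Real.exp (-y ^ 2)) =
        1 / 2 * Real.Gamma ((N + p) / 2) := by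
      have h3 := integral_rpow_mul_exp_neg_rpow (p := 2) (q := N + p - 1) two_pos (by linarith)
      rw [sub_add_cancel] at h3
      rw [← h3]
      refine setIntegral_congr_fun measurableSet_Ioi fun y hy => ?_
      have hy0 : 0 < y := hy
      simp only [finrank_euclideanSpace, Fintype.card_fin, smul_eq_mul]
      rw [← mul_assoc, ← Real.rpow_natCast, ← Real.rpow_add hy0, Nat.cast_sub hN, Real.rpow_two]
      congr 2
      push_cast
      ring
    rw [h2, measureReal_def, EuclideanSpace.volume_ball]
    simp only [ENNReal.ofReal_one, one_pow, one_mul, finrank_euclideanSpace, Fintype.card_fin,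
      smul_eq_mul, nsmul_eq_mul]
    rw [ENNReal.toReal_ofReal (div_nonneg (by positivity)
      (Real.Gamma_pos_of_pos (by positivity)).le), Real.Gamma_add_one (by positivity)]
    have := (Real.Gamma_pos_of_pos (by positivity : (0 : ℝ) < N / 2)).ne'
    field_simp
  rw [← h1, ← lintegral_ofReal_of_integral_pos (fun x => by positivity)]
  · refine lintegral_congr fun x => ?_
    rw [gaussianKernel, ENNReal.ofReal_mul (by positivity)]
  · rw [h1]
    have := Real.Gamma_pos_of_pos (by positivity : (0 : ℝ) < N / 2)
    have := Real.Gamma_pos_of_pos (by positivity : (0 : ℝ) < (N + p) / 2)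
    have := Real.pi_pos
    positivity

theorem dirMoment_gaussianKernel (hN : 1 ≤ N) {p : ℝ} (hp : 0 < p) :
    dirMoment p (gaussianKernel (N := N)) (EuclideanSpace.single (⟨0, hN⟩ : Fin N) 1) =
      ENNReal.ofReal (Real.sqrt Real.pi ^ (N - 1) * Real.Gamma ((p + 1) / 2)) := by
  set i₀ : Fin N := ⟨0, hN⟩
  have h1 : ∫ x : Rn N, |x i₀| ^ p * Real.exp (-‖x‖ ^ 2) =
      Real.sqrt Real.pi ^ (N - 1) * Real.Gamma ((p + 1) / 2) := by
    -- The integrand factors over coordinates: `N - 1` Gaussian integrals `√π` and one moment `Γ((p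
    -- + 1) / 2)`.
    have h2 : ∀ x : Rn N, |x i₀| ^ p * Real.exp (-‖x‖ ^ 2) =
        ∏ i, (if i = i₀ then |x i| ^ p else 1) * Real.exp (-(x i) ^ 2) := by
      intro x
      rw [Finset.prod_mul_distrib, Finset.prod_ite_eq' Finset.univ i₀, if_pos (Finset.mem_univ _),
        ← Real.exp_sum, EuclideanSpace.real_norm_sq_eq, Finset.sum_neg_distrib]
    simp_rw [h2]
    have h3 := (PiLp.volume_preserving_ofLp (Fin N)).integral_comp
      (MeasurableEquiv.toLp 2 (Fin N → ℝ)).symm.measurableEmbedding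
      (fun y : Fin N → ℝ => ∏ i, (if i = i₀ then |y i| ^ p else 1) * Real.exp (-(y i) ^ 2))
    rw [h3, integral_fintype_prod_volume_eq_prod
      (fun i t => (if i = i₀ then |t| ^ p else 1) * Real.exp (-t ^ 2)),
      ← Finset.mul_prod_erase Finset.univ _ (Finset.mem_univ i₀), mul_comm]
    congr 1
    · have h4 : ∀ i ∈ Finset.univ.erase i₀,
          ∫ t : ℝ, (if i = i₀ then |t| ^ p else 1) * Real.exp (-t ^ 2) = Real.sqrt Real.pi := by
        intro i hi
        simp only [if_neg (Finset.ne_of_mem_erase hi)]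
        simpa using integral_gaussian 1
      rw [Finset.prod_congr rfl h4, Finset.prod_const, Finset.card_erase_of_mem (Finset.mem_univ _),
        Finset.card_univ, Fintype.card_fin]
    · simp only [if_true]
      have h5 := integral_comp_abs (f := fun t => t ^ p * Real.exp (-t ^ 2))
      simp only [sq_abs] at h5
      rw [h5]
      have h6 := integral_rpow_mul_exp_neg_rpow (p := 2) (q := p) two_pos (by linarith)
      simp only [Real.rpow_two] at h6
      rw [h6]
      ring
  rw [← h1, ← lintegral_ofReal_of_integral_pos (fun x => by positivity)]
  · refine lintegral_congr fun x => ?_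
    rw [gaussianKernel, ENNReal.ofReal_mul (by positivity), EuclideanSpace.inner_single_left,
      ← ofReal_norm, ENNReal.ofReal_rpow_of_nonneg (norm_nonneg _) hp.le]
    simp
  · rw [h1]
    have := Real.Gamma_pos_of_pos (by positivity : (0 : ℝ) < (p + 1) / 2)
    have := Real.pi_pos
    positivity

theorem dirMoment_radial (hN : 1 ≤ N) {p : ℝ} (hp : 0 < p) {K : Rn N → ℝ≥0∞}
    (hKm : AEMeasurable K volume) (hK : IsRadial K) (a : Rn N) :
    dirMoment p K a = ‖a‖ₑ ^ p * (ENNReal.ofReal (radialConstant N p) * moment p K) := by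
  have hN0 : (0 : ℝ) < N := by exact_mod_cast hN
  set e : Rn N := EuclideanSpace.single (⟨0, hN⟩ : Fin N) 1
  have he : ‖e‖ = 1 := by simp [e]
  rw [dirMoment_eq hp hK he]
  congr 1
  have h := dirMoment_mul_moment_gaussianKernel hp hKm hK he
  have hG1 := Real.Gamma_pos_of_pos (by positivity : (0 : ℝ) < N / 2)
  have hG2 := Real.Gamma_pos_of_pos (by positivity : (0 : ℝ) < (N + p) / 2)
  have hpi := Real.sqrt_pos.2 Real.pi_pos
  have hG3 := Real.Gamma_pos_of_pos (by positivity : (0 : ℝ) < (p + 1) / 2)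
  have hc : dirMoment p (gaussianKernel (N := N)) e =
      ENNReal.ofReal (radialConstant N p) * moment p (gaussianKernel (N := N)) := by
    rw [dirMoment_gaussianKernel hN hp, moment_gaussianKernel hN hp, ← ENNReal.ofReal_mul
      (by unfold radialConstant; positivity)]
    congr 1
    unfold radialConstant
    obtain ⟨m, rfl⟩ : ∃ m, N = m + 1 := ⟨N - 1, by omega⟩
    rw [Nat.add_sub_cancel, pow_succ]
    field_simp
  rw [hc, mul_right_comm] at h
  refine (ENNReal.mul_left_inj ?_ ?_).1 h
  · rw [moment_gaussianKernel hN hp]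
    exact (ENNReal.ofReal_pos.2 (by positivity)).ne'
  · rw [moment_gaussianKernel hN hp]
    exact ENNReal.ofReal_ne_top

theorem lintegral_lintegral_inner {p : ℝ} (hN : 1 ≤ N) (hp : 0 < p) {K : Rn N → ℝ≥0∞}
    (hKm : AEMeasurable K volume) (hK : IsRadial K) {G : Rn N → Rn N}
    (hG : AEStronglyMeasurable G volume) :
    ∫⁻ w, (∫⁻ x, ‖inner ℝ (G x) w‖ₑ ^ p) * K w =
      ENNReal.ofReal (radialConstant N p) * moment p K * ∫⁻ x, ‖G x‖ₑ ^ p := by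
  have hm1 : AEMeasurable (fun z : Rn N × Rn N => ‖inner ℝ (G z.2) z.1‖ₑ ^ p)
      (volume.prod volume) :=
    ((hG.comp_snd (μ := volume)).inner (𝕜 := ℝ)
      (measurable_fst.aestronglyMeasurable)).enorm.pow_const p
  have hm : AEMeasurable (fun z : Rn N × Rn N => ‖inner ℝ (G z.2) z.1‖ₑ ^ p * K z.1)
      (volume.prod volume) :=
    hm1.mul hKm.comp_fst
  have h1 : ∀ w : Rn N, (∫⁻ x, ‖inner ℝ (G x) w‖ₑ ^ p) * K w =
      ∫⁻ x, ‖inner ℝ (G x) w‖ₑ ^ p * K w := fun w =>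
    (lintegral_mul_const'' _ ((hG.inner aestronglyMeasurable_const).enorm.pow_const p)).symm
  simp_rw [h1]
  rw [lintegral_lintegral_swap hm]
  have hm2 : AEMeasurable (fun x => ‖G x‖ₑ ^ p) volume := hG.enorm.pow_const p
  rw [← lintegral_const_mul'' _ hm2]
  refine lintegral_congr fun x => ?_
  rw [mul_comm]
  exact dirMoment_radial hN hp hKm hK (G x)

theorem radialConstant_pos (hN : 1 ≤ N) {p : ℝ} (hp : 1 ≤ p) : 0 < radialConstant N p := by
  have hN' : (0 : ℝ) < N := by exact_mod_cast hN
  unfold radialConstant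
  have h1 := Real.Gamma_pos_of_pos (s := (N : ℝ) / 2) (by positivity)
  have h2 := Real.Gamma_pos_of_pos (s := (p + 1) / 2) (by positivity)
  have h3 := Real.Gamma_pos_of_pos (s := ((N : ℝ) + p) / 2) (by positivity)
  have h4 := Real.pi_pos
  positivity

/-! ### The radial identity for `p > 1` -/

theorem dirEnergy_eq_of_hasWeakDirDeriv {p : ℝ} (hp : 1 ≤ p) (hp1 : p ≠ 1) {u : Rn N → ℝ}
    {v : Rn N} {g : Rn N → ℝ} (hg : MemLp g (expo p)) (h : HasWeakDirDeriv u v g) :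
    dirEnergy p u v = ∫⁻ x, ‖g x‖ₑ ^ p := by
  rw [dirEnergy, if_neg hp1]
  refine le_antisymm (iInf_le_of_le ⟨g, hg, h⟩ le_rfl) (le_iInf fun ⟨g', hg', h'⟩ => ?_)
  refine (lintegral_congr_ae ?_).le
  have hae : g =ᵐ[volume] g' := by
    refine ae_eq_of_test (locallyIntegrable_of_memLp hp hg) (locallyIntegrable_of_memLp hp hg')
      fun φ hφ => ?_
    have e1 := h φ hφ
    have e2 := h' φ hφ
    linarith
  filter_upwards [hae] with x hx
  rw [hx]

theorem gradEnergy_eq_of_hasWeakGradient {p : ℝ} (hp : 1 ≤ p) (hp1 : p ≠ 1) {u : Rn N → ℝ}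
    {G : Rn N → Rn N} (hG : MemLp G (expo p)) (h : HasWeakGradient u G) :
    gradEnergy p u = ∫⁻ x, ‖G x‖ₑ ^ p := by
  rw [gradEnergy, if_neg hp1]
  refine le_antisymm (iInf_le_of_le ⟨G, hG, h⟩ le_rfl) (le_iInf fun ⟨G', hG', h'⟩ => ?_)
  refine (lintegral_congr_ae ?_).le
  have hae : ∀ i : Fin N, ∀ᵐ x, inner ℝ (G x) (EuclideanSpace.single i (1 : ℝ)) =
      inner ℝ (G' x) (EuclideanSpace.single i (1 : ℝ)) := by
    intro i
    refine ae_eq_of_test (locallyIntegrable_of_memLp hp (hG.inner_const _))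
      (locallyIntegrable_of_memLp hp (hG'.inner_const _)) fun φ hφ => ?_
    have e1 := h (EuclideanSpace.single i 1) φ hφ
    have e2 := h' (EuclideanSpace.single i 1) φ hφ
    linarith
  filter_upwards [ae_all_iff.2 hae] with x hx
  have : G x = G' x := by
    ext i
    simpa [EuclideanSpace.inner_single_right] using hx i
  rw [this]

/-- With a gradient in `L^p` this is Tonelli. Without one both sides are infinite: the left by the
coercivity argument, the right as an empty infimum times a positive constant. -/
theorem lintegral_dirEnergy_radial_of_ne_one {p : ℝ} (hN : 1 ≤ N) (hp : 1 ≤ p) (hp1 : p ≠ 1)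
    {K : Rn N → ℝ≥0∞} (hKm : AEMeasurable K volume) (hK : IsRadial K)
    (hKne : ¬ ∀ᵐ x : Rn N, K x = 0) {u : Rn N → ℝ} (hu : MemLp u (expo p)) :
    ∫⁻ w, dirEnergy p u w * K w =
      ENNReal.ofReal (radialConstant N p) * moment p K * gradEnergy p u := by
  by_cases hex : ∃ G : Rn N → Rn N, MemLp G (expo p) ∧ HasWeakGradient u G
  · obtain ⟨G, hG, h⟩ := hex
    rw [gradEnergy_eq_of_hasWeakGradient hp hp1 hG h,
      ← lintegral_lintegral_inner hN (by linarith) hKm hK hG.1]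
    refine lintegral_congr fun w => ?_
    rw [dirEnergy_eq_of_hasWeakDirDeriv hp hp1 (hG.inner_const w) (h w)]
  · have h1 : gradEnergy p u = ⊤ := by
      rw [gradEnergy, if_neg hp1]
      exact iInf_eq_top.2 fun ⟨G, hG⟩ => absurd ⟨G, hG⟩ hex
    rw [h1, ENNReal.mul_top]
    · by_contra hne
      have h2 := mem_sobolevBV_of_dirEnergy hp hu
        (dirEnergy_lt_top_of_lintegral hp hKm hKne hu (lt_top_iff_ne_top.2 hne))
      have h3 := h2.2
      rw [if_neg hp1] at h3
      exact hex h3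
    · exact mul_ne_zero (ENNReal.ofReal_pos.2 (radialConstant_pos hN hp)).ne'
        (moment_ne_zero hN hKm hKne)

/-! ### Mollification -/

section

variable {F : Type*} [NormedAddCommGroup F] [NormedSpace ℝ F]

/-- The convolution `η ⋆ f`. -/
noncomputable def mollify (η : Rn N → ℝ) (f : Rn N → F) : Rn N → F :=
  convolution η f (ContinuousLinearMap.lsmul ℝ ℝ) volume

theorem mollify_apply (η : Rn N → ℝ) (f : Rn N → F) (x : Rn N) :
    mollify η f x = ∫ y, η (x - y) • f y := by
  rw [mollify, convolution_lsmul_swap]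

theorem IsTest.mollify {η : Rn N → ℝ} (hη : IsTest η) {Φ : Rn N → F} (hΦ : IsTest Φ) :
    IsTest (mollify η Φ) :=
  ⟨hΦ.2.contDiff_convolution_right _ hη.continuous.locallyIntegrable hΦ.1,
    HasCompactSupport.convolution _ hη.2 hΦ.2⟩

theorem IsTest.fderiv_mollify {η : Rn N → ℝ} (hη : IsTest η) {Φ : Rn N → F} (hΦ : IsTest Φ)
    (x v : Rn N) : fderiv ℝ (NonlocalBBM.mollify η Φ) x v =
      NonlocalBBM.mollify η (fun y => fderiv ℝ Φ y v) x := by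
  have hL := hη.continuous.locallyIntegrable (μ := volume)
  have h1 := hΦ.2.hasFDerivAt_convolution_right (ContinuousLinearMap.lsmul ℝ ℝ) hL
    (hΦ.1.of_le (by simp)) x
  unfold NonlocalBBM.mollify
  rw [h1.fderiv]
  exact convolution_precompR_apply _ hL (hΦ.2.fderiv ℝ)
    (hΦ.1.continuous_fderiv (by simp)) x v

theorem norm_mollify_le {η : Rn N → ℝ} (hη : Integrable η) (hη0 : ∀ x, 0 ≤ η x)
    (hη1 : ∫ x, η x = 1) {f : Rn N → F} {C : ℝ} (hf : ∀ x, ‖f x‖ ≤ C) (x : Rn N) :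
    ‖mollify η f x‖ ≤ C := by
  rw [mollify_apply]
  have h1 : Integrable fun y => η (x - y) * C := (hη.comp_sub_left x).mul_const C
  refine (norm_integral_le_of_norm_le h1 (Eventually.of_forall fun y => ?_)).trans ?_
  · rw [norm_smul, Real.norm_of_nonneg (hη0 _)]
    exact mul_le_mul_of_nonneg_left (hf y) (hη0 _)
  · rw [integral_mul_const, integral_sub_left_eq_self (fun y => η y) volume x, hη1, one_mul]

end

theorem mollify_comm (η φ : Rn N → ℝ) : mollify η φ = mollify φ η := by
  ext x
  rw [mollify_apply, mollify, convolution_lsmul]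
  simp_rw [smul_eq_mul, mul_comm]

theorem IsTest.mollify_fderiv {η φ : Rn N → ℝ} (hη : IsTest η) (hφ : IsTest φ) (x v : Rn N) :
    NonlocalBBM.mollify (fun y => fderiv ℝ η y v) φ x =
      NonlocalBBM.mollify η (fun y => fderiv ℝ φ y v) x := by
  rw [mollify_comm, ← hφ.fderiv_mollify hη, mollify_comm, hη.fderiv_mollify hφ]

theorem integral_mollify_mul {η : Rn N → ℝ} (hη : IsTest η) {u : Rn N → ℝ} (hu : Integrable u)
    {ξ : Rn N → ℝ} (hξ : IsTest ξ) :
    ∫ x, mollify η u x * ξ x = ∫ x, u x * mollify (fun y => η (-y)) ξ x := by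
  obtain ⟨C, hC⟩ := hξ.2.exists_bound_of_continuous hξ.continuous
  have h1 : Integrable (fun z : Rn N × Rn N => η (z.1 - z.2) * u z.2 * ξ z.1)
      (volume.prod volume) := by
    have h2 := hu.convolution_integrand (ContinuousLinearMap.lsmul ℝ ℝ) hη.integrable
    refine (h2.mul_bdd (c := C) (g := fun z => ξ z.1)
      (hξ.continuous.comp continuous_fst).aestronglyMeasurable
      (Eventually.of_forall fun z => hC z.1)).congr (Eventually.of_forall fun z => ?_)
    simp only [ContinuousLinearMap.lsmul_apply, smul_eq_mul]
    ring
  have e1 : ∀ x, mollify η u x * ξ x = ∫ y, η (x - y) * u y * ξ x := fun x => by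
    rw [mollify_apply, ← integral_mul_const]
    rfl
  have e2 : ∀ y, u y * mollify (fun y => η (-y)) ξ y = ∫ x, η (x - y) * u y * ξ x := fun y => by
    rw [mollify_apply, ← integral_const_mul]
    refine integral_congr_ae (Eventually.of_forall fun x => ?_)
    simp only [neg_sub, smul_eq_mul]
    ring
  simp_rw [e1, e2]
  exact integral_integral_swap h1

theorem integrable_mollify {η u : Rn N → ℝ} (hη : Integrable η) (hu : Integrable u) :
    Integrable (mollify η u) :=
  hη.integrable_convolution _ hu

/-- An even mollifier of unit mass. -/
structure IsMollifier (ρ : Rn N → ℝ) : Prop where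
  isTest : IsTest ρ
  nonneg : ∀ x, 0 ≤ ρ x
  integral_eq : ∫ x, ρ x = 1
  even : ∀ x, ρ (-x) = ρ x

namespace IsMollifier

variable {ρ : Rn N → ℝ} {u : Rn N → ℝ}

/-- Evenness of `ρ` makes mollification self-adjoint, so it can be moved onto test functions, where
it commutes with derivatives and preserves the bound `1`. -/
theorem integral_mul (h : IsMollifier ρ) (hu : Integrable u) {ξ : Rn N → ℝ} (hξ : IsTest ξ) :
    ∫ x, mollify ρ u x * ξ x = ∫ x, u x * mollify ρ ξ x := by
  rw [integral_mollify_mul h.isTest hu hξ]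
  simp_rw [h.even]

theorem hasWeakDirDeriv (h : IsMollifier ρ) (hu : Integrable u) (v : Rn N) :
    HasWeakDirDeriv (mollify ρ u) v (mollify (fun y => fderiv ℝ ρ y v) u) := by
  intro φ hφ
  rw [h.integral_mul hu (hφ.fderiv_apply v),
    integral_mollify_mul (h.isTest.fderiv_apply v) hu hφ, ← integral_neg]
  refine integral_congr_ae (Eventually.of_forall fun x => ?_)
  -- The derivative of an even function is odd; this supplies the sign in the integration by parts.
  have hodd : ∀ y, fderiv ℝ ρ (-y) v = -fderiv ℝ ρ y v := by
    intro y
    have h1 : ρ ∘ Neg.neg = ρ := funext h.even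
    have h2 := (h.isTest.differentiable (- -y)).hasFDerivAt.comp (-y)
      ((hasFDerivAt_id (𝕜 := ℝ) (-y)).neg)
    have h3 : HasFDerivAt (ρ ∘ Neg.neg)
      ((fderiv ℝ ρ (- -y)).comp (-ContinuousLinearMap.id ℝ (Rn N))) (-y) := h2
    rw [h1] at h3
    rw [h3.fderiv, neg_neg]
    simp
  simp only [hodd]
  rw [← h.isTest.mollify_fderiv hφ, mollify_apply, mollify_apply]
  simp only [neg_smul, integral_neg, mul_neg, neg_neg]

theorem hasWeakGradient (h : IsMollifier ρ) (hu : Integrable u) :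
    ∃ G : Rn N → Rn N, MemLp G (expo 1) ∧ HasWeakGradient (mollify ρ u) G := by
  have e : expo 1 = 1 := ENNReal.ofReal_one
  have hg : ∀ i : Fin N, MemLp (mollify (fun y => fderiv ℝ ρ y (EuclideanSpace.single i 1)) u)
      (expo 1) := fun i => by
    rw [e, memLp_one_iff_integrable]
    exact integrable_mollify (h.isTest.fderiv_apply _).integrable hu
  exact ⟨_, memLp_finsetSum _ fun i _ =>
      (ContinuousLinearMap.toSpanSingleton ℝ (EuclideanSpace.single i (1 : ℝ))).comp_memLp' (hg i),
    hasWeakGradient_of_coord le_rfl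
      (integrable_mollify h.isTest.integrable hu).locallyIntegrable hg
      fun i => h.hasWeakDirDeriv hu _⟩

/-- If `φ` is admissible, so is `mollify ρ φ`; hence mollification cannot increase the variation. -/
theorem dirVariation_le (h : IsMollifier ρ) (hu : Integrable u) (v : Rn N) :
    dirVariation (mollify ρ u) v ≤ dirVariation u v := by
  refine iSup_le fun ⟨φ, hφ, hφ1⟩ => ?_
  dsimp only
  rw [h.integral_mul hu (hφ.fderiv_apply v)]
  simp_rw [← h.isTest.fderiv_mollify hφ]
  exact le_iSup (fun φ : {φ : Rn N → ℝ // IsTest φ ∧ ∀ x, |φ x| ≤ 1} =>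
    ENNReal.ofReal (∫ x, u x * fderiv ℝ φ.1 x v)) ⟨mollify ρ φ, h.isTest.mollify hφ, fun x =>
      norm_mollify_le h.isTest.integrable h.nonneg h.integral_eq (f := φ) hφ1 x⟩

theorem _root_.NonlocalBBM.isTest_divergence {Φ : Rn N → Rn N} (hΦ : IsTest Φ) :
    IsTest (divergence Φ) := by
  have h1 : ∀ i : Fin N, IsTest fun x => fderiv ℝ Φ x (EuclideanSpace.single i 1) i := fun i =>
    (hΦ.fderiv_apply _).coord i
  refine ⟨ContDiff.sum fun i _ => (h1 i).1, ?_⟩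
  have h2 : divergence Φ = ∑ i : Fin N, fun x => fderiv ℝ Φ x (EuclideanSpace.single i 1) i := by
    ext x
    simp [divergence]
  rw [h2]
  exact ((testSpace N).sum_mem fun i _ => h1 i).2

theorem divergence_mollify (h : IsMollifier ρ) {Φ : Rn N → Rn N} (hΦ : IsTest Φ) (x : Rn N) :
    divergence (mollify ρ Φ) x = mollify ρ (divergence Φ) x := by
  have hi : ∀ i : Fin N, Integrable fun y =>
      ρ (x - y) • fderiv ℝ Φ y (EuclideanSpace.single i 1) := fun i => by
    have ht := hΦ.fderiv_apply (EuclideanSpace.single i 1)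
    have hc : Continuous fun y => ρ (x - y) :=
      h.isTest.continuous.comp (continuous_const.sub continuous_id)
    have hs : HasCompactSupport
        ((fun y => ρ (x - y)) • fun y => fderiv ℝ Φ y (EuclideanSpace.single i 1)) :=
      ht.2.smul_left
    exact (hc.smul ht.continuous).integrable_of_hasCompactSupport hs
  have e1 : ∀ i : Fin N, mollify ρ (fun y => fderiv ℝ Φ y (EuclideanSpace.single i 1)) x i =
      ∫ y, ρ (x - y) * fderiv ℝ Φ y (EuclideanSpace.single i 1) i := fun i => by
    rw [mollify_apply]
    exact ((EuclideanSpace.proj (𝕜 := ℝ) i).integral_comp_comm (hi i)).symm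
  have hi' : ∀ i : Fin N, Integrable fun y =>
      ρ (x - y) * fderiv ℝ Φ y (EuclideanSpace.single i 1) i := fun i =>
    (EuclideanSpace.proj (𝕜 := ℝ) i).integrable_comp (hi i)
  rw [mollify_apply]
  unfold divergence
  simp_rw [h.isTest.fderiv_mollify hΦ, e1, smul_eq_mul, Finset.mul_sum]
  exact (integral_finsetSum _ fun i _ => hi' i).symm

theorem totalVariation_le (h : IsMollifier ρ) (hu : Integrable u) :
    totalVariation (mollify ρ u) ≤ totalVariation u := by
  refine iSup_le fun ⟨Φ, hΦ, hΦ1⟩ => ?_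
  dsimp only
  rw [h.integral_mul hu (isTest_divergence hΦ)]
  simp_rw [← h.divergence_mollify hΦ]
  exact le_iSup (fun Φ : {Φ : Rn N → Rn N // IsTest Φ ∧ ∀ x, ‖Φ x‖ ≤ 1} =>
    ENNReal.ofReal (∫ x, u x * divergence Φ.1 x)) ⟨mollify ρ Φ, h.isTest.mollify hΦ,
      norm_mollify_le h.isTest.integrable h.nonneg h.integral_eq hΦ1⟩

end IsMollifier

/-! ### The case of functions of bounded variation -/

theorem dirVariation_eq_lintegral {u : Rn N → ℝ} {v : Rn N} {g : Rn N → ℝ} (hg : Integrable g)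
    (h : HasWeakDirDeriv u v g) : dirVariation u v = ∫⁻ x, ‖g x‖ₑ := by
  refine le_antisymm (iSup_le fun ⟨φ, hφ, hφ1⟩ => ?_)
    (lintegral_enorm_le_of_test hg fun φ hφ hφ1 => ?_)
  · dsimp only
    rw [h φ hφ, ← integral_neg]
    refine (Real.ofReal_le_enorm _).trans ((enorm_integral_le_lintegral_enorm _).trans
      (lintegral_mono fun x => ?_))
    rw [enorm_neg, enorm_mul]
    refine mul_le_of_le_one_right' ?_
    rw [← ofReal_norm]
    exact ENNReal.ofReal_le_one.2 (hφ1 x)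
  · have h1 := h _ hφ.neg
    have e1 : ∫ x, inner ℝ (g x) (φ x) = ∫ x, u x * fderiv ℝ (-φ) x v := by
      rw [h1, ← integral_neg]
      refine integral_congr_ae (Eventually.of_forall fun x => ?_)
      simp [mul_comm]
    rw [e1]
    exact le_iSup (fun φ : {φ : Rn N → ℝ // IsTest φ ∧ ∀ x, |φ x| ≤ 1} =>
      ENNReal.ofReal (∫ x, u x * fderiv ℝ φ.1 x v)) ⟨-φ, hφ.neg, fun x => by
        simpa using hφ1 x⟩

theorem HasWeakGradient.integral_mul_divergence {u : Rn N → ℝ} (hu : LocallyIntegrable u)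
    {G : Rn N → Rn N} (hG : Integrable G) (h : HasWeakGradient u G) {Φ : Rn N → Rn N}
    (hΦ : IsTest Φ) : ∫ x, u x * divergence Φ x = -∫ x, inner ℝ (G x) (Φ x) := by
  have e1 : ∀ x, u x * divergence Φ x =
      ∑ i : Fin N, u x * fderiv ℝ (fun x => Φ x i) x (EuclideanSpace.single i 1) := fun x => by
    rw [divergence, Finset.mul_sum]
    simp_rw [fderiv_coord hΦ]
  have e2 : ∀ x, inner ℝ (G x) (Φ x) =
      ∑ i : Fin N, inner ℝ (G x) (EuclideanSpace.single i (1 : ℝ)) * Φ x i := fun x => by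
    rw [PiLp.inner_apply]
    refine Finset.sum_congr rfl fun i _ => ?_
    simp [EuclideanSpace.inner_single_right, mul_comm]
  simp_rw [e1, e2]
  rw [integral_finsetSum _ fun i _ =>
      ((hΦ.coord i).fderiv_apply (EuclideanSpace.single i 1)).integrable_mul hu,
    integral_finsetSum _ fun i _ => (hΦ.coord i).integrable_mul
      (hG.inner_const (𝕜 := ℝ) (EuclideanSpace.single i 1)).locallyIntegrable,
    ← Finset.sum_neg_distrib]
  exact Finset.sum_congr rfl fun i _ => h _ _ (hΦ.coord i)

theorem totalVariation_eq_lintegral {u : Rn N → ℝ} (hu : LocallyIntegrable u)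
    {G : Rn N → Rn N} (hG : Integrable G) (h : HasWeakGradient u G) :
    totalVariation u = ∫⁻ x, ‖G x‖ₑ := by
  refine le_antisymm (iSup_le fun ⟨Φ, hΦ, hΦ1⟩ => ?_)
    (lintegral_enorm_le_of_test hG fun Φ hΦ hΦ1 => ?_)
  · dsimp only
    rw [h.integral_mul_divergence hu hG hΦ, ← integral_neg]
    refine (Real.ofReal_le_enorm _).trans ((enorm_integral_le_lintegral_enorm _).trans
      (lintegral_mono fun x => ?_))
    rw [enorm_neg, ← ofReal_norm, ← ofReal_norm]
    refine ENNReal.ofReal_le_ofReal ((norm_inner_le_norm _ _).trans ?_)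
    exact mul_le_of_le_one_right (norm_nonneg _) (hΦ1 x)
  · have h1 := h.integral_mul_divergence hu hG hΦ.neg
    have e1 : ∫ x, inner ℝ (G x) (Φ x) = ∫ x, u x * divergence (-Φ) x := by
      rw [h1, ← integral_neg]
      refine integral_congr_ae (Eventually.of_forall fun x => ?_)
      simp
    rw [e1]
    exact le_iSup (fun Φ : {Φ : Rn N → Rn N // IsTest Φ ∧ ∀ x, ‖Φ x‖ ≤ 1} =>
      ENNReal.ofReal (∫ x, u x * divergence Φ.1 x)) ⟨-Φ, hΦ.neg, fun x => by
        simpa using hΦ1 x⟩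

/-- A bump function supported in the ball of radius `1 / (n + 1)`. -/
noncomputable def bump (N n : ℕ) : ContDiffBump (0 : Rn N) where
  rIn := 1 / (n + 2)
  rOut := 1 / (n + 1)
  rIn_pos := by positivity
  rIn_lt_rOut := one_div_lt_one_div_of_lt (by positivity) (by linarith)

theorem isMollifier_bump (N n : ℕ) : IsMollifier ((bump N n).normed volume) where
  isTest := ⟨(bump N n).contDiff_normed, (bump N n).hasCompactSupport_normed⟩
  nonneg := (bump N n).nonneg_normed
  integral_eq := (bump N n).integral_normed
  even := (bump N n).normed_neg

/-- Smooth approximations of `u`. -/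
noncomputable def smoothing (n : ℕ) (u : Rn N → ℝ) : Rn N → ℝ :=
  mollify ((bump N n).normed volume) u

theorem tendsto_integral_smoothing_mul {u : Rn N → ℝ} (hu : Integrable u) {ξ : Rn N → ℝ}
    (hξ : IsTest ξ) :
    Tendsto (fun n => ∫ x, smoothing n u x * ξ x) atTop (𝓝 (∫ x, u x * ξ x)) := by
  obtain ⟨C, hC⟩ := hξ.2.exists_bound_of_continuous hξ.continuous
  have e : ∀ n, ∫ x, smoothing n u x * ξ x =
      ∫ x, u x * mollify ((bump N n).normed volume) ξ x := fun n =>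
    (isMollifier_bump N n).integral_mul hu hξ
  simp_rw [e]
  refine tendsto_integral_of_dominated_convergence (fun x => ‖u x‖ * C) (fun n => ?_)
    (hu.norm.mul_const C) (fun n => Eventually.of_forall fun x => ?_)
    (Eventually.of_forall fun x => Tendsto.const_mul _ ?_)
  · exact hu.1.mul ((isMollifier_bump N n).isTest.mollify hξ).continuous.aestronglyMeasurable
  · rw [norm_mul]
    have hn := isMollifier_bump N n
    exact mul_le_mul_of_nonneg_left
      (norm_mollify_le hn.isTest.integrable hn.nonneg hn.integral_eq hC x) (norm_nonneg _)
  · exact ContDiffBump.convolution_tendsto_right_of_continuous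
      tendsto_one_div_add_atTop_nhds_zero_nat hξ.continuous x

/-- Each pairing with a fixed test function converges, and a supremum of such limits is lower
semicontinuous. -/
theorem dirVariation_le_liminf {u : Rn N → ℝ} (hu : Integrable u) (v : Rn N) :
    dirVariation u v ≤ liminf (fun n => dirVariation (smoothing n u) v) atTop := by
  refine iSup_le fun φ => ?_
  have h1 := (ENNReal.continuous_ofReal.tendsto _).comp
    (tendsto_integral_smoothing_mul hu (φ.2.1.fderiv_apply v))
  rw [← h1.liminf_eq]
  exact liminf_le_liminf (Eventually.of_forall fun n =>
    le_iSup (fun φ : {φ : Rn N → ℝ // IsTest φ ∧ ∀ x, |φ x| ≤ 1} =>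
      ENNReal.ofReal (∫ x, smoothing n u x * fderiv ℝ φ.1 x v)) φ)

theorem totalVariation_le_liminf {u : Rn N → ℝ} (hu : Integrable u) :
    totalVariation u ≤ liminf (fun n => totalVariation (smoothing n u)) atTop := by
  refine iSup_le fun Φ => ?_
  have h1 := (ENNReal.continuous_ofReal.tendsto _).comp
    (tendsto_integral_smoothing_mul hu (isTest_divergence Φ.2.1))
  rw [← h1.liminf_eq]
  exact liminf_le_liminf (Eventually.of_forall fun n =>
    le_iSup (fun Φ : {Φ : Rn N → Rn N // IsTest Φ ∧ ∀ x, ‖Φ x‖ ≤ 1} =>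
      ENNReal.ofReal (∫ x, smoothing n u x * divergence Φ.1 x)) Φ)

/-- Smoothed functions have an integrable gradient, so Tonelli gives the identity for them.
Smoothing increases neither side, and both sides are lower semicontinuous as it is removed, so the
identity passes to `u`, infinite variation included. -/
theorem lintegral_dirVariation_radial {K : Rn N → ℝ≥0∞} (hN : 1 ≤ N)
    (hKm : AEMeasurable K volume) (hK : IsRadial K) {u : Rn N → ℝ}
    (hu : Integrable u) :
    ∫⁻ w, dirVariation u w * K w =
      ENNReal.ofReal (radialConstant N 1) * moment 1 K * totalVariation u := by
  set c := ENNReal.ofReal (radialConstant N 1) * moment 1 K with hc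
  have hint : ∀ n, Integrable (smoothing n u) := fun n =>
    integrable_mollify (isMollifier_bump N n).isTest.integrable hu
  have hmeas : ∀ n, Measurable (dirVariation (smoothing n u)) := fun n => by
    have h1 : MemLp (smoothing n u) (expo 1) := by
      rw [expo, ENNReal.ofReal_one]
      exact memLp_one_iff_integrable.2 (hint n)
    have h2 := measurable_dirEnergy le_rfl h1
    unfold dirEnergy at h2
    simpa only [if_true] using h2
  have hsmooth : ∀ n, ∫⁻ w, dirVariation (smoothing n u) w * K w =
      c * totalVariation (smoothing n u) := fun n => by
    obtain ⟨G, hG, h⟩ := (isMollifier_bump N n).hasWeakGradient hu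
    change HasWeakGradient (smoothing n u) G at h
    rw [expo, ENNReal.ofReal_one] at hG
    have hGi := memLp_one_iff_integrable.1 hG
    have h1 := lintegral_lintegral_inner hN one_pos hKm hK hGi.1
    simp only [ENNReal.rpow_one] at h1
    rw [totalVariation_eq_lintegral (hint n).locallyIntegrable hGi h, hc, ← h1]
    refine lintegral_congr fun w => ?_
    rw [dirVariation_eq_lintegral (hGi.inner_const w) (h w)]
  refine le_antisymm ?_ ?_
  · calc ∫⁻ w, dirVariation u w * K w
        ≤ ∫⁻ w, liminf (fun n => dirVariation (smoothing n u) w * K w) atTop := by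
          refine lintegral_mono fun w => ?_
          refine le_trans ?_ ENNReal.le_liminf_mul
          rw [liminf_const]
          exact mul_le_mul_left (dirVariation_le_liminf hu w) _
      _ ≤ liminf (fun n => ∫⁻ w, dirVariation (smoothing n u) w * K w) atTop :=
          lintegral_liminf_le' fun n => (hmeas n).aemeasurable.mul hKm
      _ ≤ c * totalVariation u := by
          simp_rw [hsmooth]
          refine (liminf_le_liminf (Eventually.of_forall fun n =>
            mul_le_mul_right ((isMollifier_bump N n).totalVariation_le hu) c)).trans ?_
          rw [liminf_const]
  · calc c * totalVariation u
        ≤ liminf (fun n => c * totalVariation (smoothing n u)) atTop := by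
          refine le_trans ?_ ENNReal.le_liminf_mul
          rw [liminf_const]
          exact mul_le_mul_right (totalVariation_le_liminf hu) _
      _ ≤ ∫⁻ w, dirVariation u w * K w := by
          simp_rw [← hsmooth]
          refine (liminf_le_liminf (Eventually.of_forall fun n => lintegral_mono fun w =>
            mul_le_mul_left ((isMollifier_bump N n).dirVariation_le hu w) (K w))).trans ?_
          rw [liminf_const]

/-- For radial kernels the average of the directional energies is a multiple of the energy of the
gradient. -/
theorem lintegral_dirEnergy_radial {p : ℝ} (hN : 1 ≤ N) (hp : 1 ≤ p) {K : Rn N → ℝ≥0∞}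
    (hKm : AEMeasurable K volume) (hK : IsRadial K) (hKne : ¬ ∀ᵐ x : Rn N, K x = 0)
    {u : Rn N → ℝ} (hu : MemLp u (expo p)) :
    ∫⁻ w, dirEnergy p u w * K w =
      ENNReal.ofReal (radialConstant N p) * moment p K * gradEnergy p u := by
  by_cases hp1 : p = 1
  · subst hp1
    rw [expo, ENNReal.ofReal_one] at hu
    unfold dirEnergy gradEnergy
    simp only [if_true]
    exact lintegral_dirVariation_radial hN hKm hK (memLp_one_iff_integrable.1 hu)
  · exact lintegral_dirEnergy_radial_of_ne_one hN hp hp1 hKm hK hKne hu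

end NonlocalBBM

theorem mainTheorem11 (N : ℕ) (hN : 1 ≤ N) (p : ℝ) (hp : 1 ≤ p)
    (K : NonlocalBBM.Rn N → ℝ≥0∞) (hKmeas : AEMeasurable K volume)
    (hKne : ¬ (∀ᵐ x : NonlocalBBM.Rn N, K x = 0))
    (hKmoment : NonlocalBBM.moment p K < ⊤)
    (β : ℝ → ℝ) (hβpos : ∀ t ∈ Ioo (0 : ℝ) 1, 0 < β t)
    (hβ : Tendsto β (𝓝[>] 0) atTop) :
    NonlocalBBM.ConvergesWithCoercivity p
      (fun t u => NonlocalBBM.nonlocalEnergy p K (β t) u)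
      (fun u => NonlocalBBM.moment p K * NonlocalBBM.anisotropicEnergy p K u) ∧
    (NonlocalBBM.IsRadial K →
      NonlocalBBM.ConvergesWithCoercivity p
        (fun t u => NonlocalBBM.nonlocalEnergy p K (β t) u)
        (fun u => ENNReal.ofReal (NonlocalBBM.radialConstant N p) *
          NonlocalBBM.moment p K * NonlocalBBM.gradEnergy p u)) := by
  refine ⟨NonlocalBBM.convergesWithCoercivity_of_eq hp hKmeas hKne hβpos hβ fun u hu =>
      NonlocalBBM.moment_mul_anisotropicEnergy hp hN hKmeas
        (NonlocalBBM.moment_ne_zero hN hKmeas hKne) hKmoment.ne hu,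
    fun hrad => NonlocalBBM.convergesWithCoercivity_of_eq hp hKmeas hKne hβpos hβ fun u hu =>
      (NonlocalBBM.lintegral_dirEnergy_radial hN hp hKmeas hrad hKne hu).symm⟩
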